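/- Let $\mathfrak X$ and $U$ be separable Hilbert spaces (both real or both complex), let $T>0$, let $A:D(A)\subset\mathfrak X\to\mathfrak X$ be the generator of a $C_0$-semigroup $(\mathfrak U(t))_{t\ge 0}$ on $\mathfrak X$ such that $\mathfrak U(t)$ is a compact operator for every $t>0$, and let $B:U\to\mathfrak X$ be a bounded linear operator. Let $f,g:[0,T]\times\mathfrak X\to\mathfrak X$ be continuous functions such that: (F) for every $t\in[0,T]$ the map $f(t,\cdot)$ is Fréchet differentiable on $\mathfrak X$, its derivative $f'_z:[0,T]\times\mathfrak X\to L(\mathfrak X)$ is continuous (for the operator norm), and there is $L>0$ with $\|f'_z(t,z)\|_{L(\mathfrak X)}\le L$ for all $(t,z)\in[0,T]\times\mathfrak X$; (G) there is a continuous $m:[0,T]\to[0,\infty)$ with $\|g(t,z)\|\le m(t)$ for all $(t,z)\in[0,T]\times\mathfrak X$. For $N:[0,T]\times\mathfrak X\to\mathfrak X$, $y_0\in\mathfrak X$ and $u\in L^2([0,T],U)$, a mild solution of $$y'(t)=Ay(t)+Bu(t)+N(t,y(t)),\quad t\in[0,T],\qquad y(0)=y_0,$$ is a function $y\in C([0,T],\mathfrak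 X)$ with $$y(t)=\mathfrak U(t)y_0+\int_0^t\mathfrak U(t-s)\bigl[Bu(s)+N(s,y(s))\bigr]\,ds\qquad\text{for all }t\in[0,T].$$ The system is called approximately controllable on $[0,T]$ if for all $y_0,y_f\in\mathfrak X$ and every $\varepsilon>0$ there are a control $u\in L^2([0,T],U)$ and a mild solution $y$ with $y(0)=y_0$ and $\|y(T)-y_f\|<\varepsilon$. Assume further: (AC) for every $G\in L^2(0,T;L(\mathfrak X))$ (Bochner space for the operator norm) the linear system $y'=Ay+Bu+G(t)y$ is approximately controllable on $[0,T]$. Then the semilinear system $y'=Ay+Bu+f(t,y)+g(t,y)$ is finite-approximately controllable on $[0,T]$: for every finite-dimensional subspace $M\subset\mathfrak X$, with orthogonal projection $\pi_M$ of $\mathfrak X$ onto $M$, for all $y_0,y_f\in\mathfrak X$ and every $\varepsilon>0$, there are a control $u\in L^2([0,T],U)$ and a mild solution $y$ of $$y'(t)=Ay(t)+Bu(t)+f(t,y(t))+g(t,y(t)),\qquad y(0)=y_0,$$ such that $\|y(T)-y_f\|<\varepsilon$ and $\pi_My(T)=\pi_My_f$. -/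

import Mathlib

open MeasureTheory Set Filter Topology

/-- A strongly continuous one-parameter semigroup `(S t)_{t ≥ 0}` of bounded linear operators.
The values at negative times carry no information and are never used. -/
structure C0Semigroup (𝕜 X : Type*) [RCLike 𝕜] [NormedAddCommGroup X] [InnerProductSpace 𝕜 X] where
  toFun : ℝ → X →L[𝕜] X
  map_zero : toFun 0 = ContinuousLinearMap.id 𝕜 X
  map_add : ∀ s t : ℝ, 0 ≤ s → 0 ≤ t → toFun (s + t) = (toFun s).comp (toFun t)
  strong_continuity : ∀ x : X, ContinuousOn (fun t => toFun t x) (Ici 0)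

instance (𝕜 X : Type*) [RCLike 𝕜] [NormedAddCommGroup X] [InnerProductSpace 𝕜 X] :
    CoeFun (C0Semigroup 𝕜 X) (fun _ => ℝ → X →L[𝕜] X) := ⟨C0Semigroup.toFun⟩

section

variable {𝕜 X U : Type*} [RCLike 𝕜] [NormedAddCommGroup X] [InnerProductSpace 𝕜 X]
  [NormedSpace ℝ X] [NormedAddCommGroup U] [InnerProductSpace 𝕜 U]

/-- `A` is the infinitesimal generator of `S`: one has `x ∈ D(A)` and `A x = w` exactly when
`(S h x - x) / h → w` as `h → 0+`. -/
def C0Semigroup.IsGenerator (S : C0Semigroup 𝕜 X) (A : X →ₗ.[𝕜] X) : Prop :=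
  ∀ x w : X, (x, w) ∈ A.graph ↔
    Tendsto (fun h : ℝ => h⁻¹ • (S h x - x)) (𝓝[>] 0) (𝓝 w)

/-- The semigroup is compact: `S t` is a compact operator for each `t > 0`. -/
def C0Semigroup.IsCompact (S : C0Semigroup 𝕜 X) : Prop :=
  ∀ t : ℝ, 0 < t → IsCompactOperator (S t)

/-- `y` is a mild solution on `[0, T]` of `y' = A y + B u + N(t, y)`, `y(0) = y₀`, where `A`
generates `S`. -/
def IsMildSolution (S : C0Semigroup 𝕜 X) (B : U →L[𝕜] X) (N : ℝ → X → X) (T : ℝ)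
    (y₀ : X) (u : ℝ → U) (y : ℝ → X) : Prop :=
  ContinuousOn y (Icc 0 T) ∧
    ∀ t ∈ Icc (0 : ℝ) T, y t = S t y₀ + ∫ s in (0 : ℝ)..t, S (t - s) (B (u s) + N s (y s))

/-- Approximate controllability on `[0, T]` of `y' = A y + B u + N(t, y)`, with controls in
`L²([0, T], U)`. -/
def ApproximatelyControllable (S : C0Semigroup 𝕜 X) (B : U →L[𝕜] X) (N : ℝ → X → X)
    (T : ℝ) : Prop :=
  ∀ y₀ yf : X, ∀ ε : ℝ, 0 < ε →
    ∃ (u : ℝ → U) (y : ℝ → X), MemLp u 2 (volume.restrict (Icc 0 T)) ∧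
      IsMildSolution S B N T y₀ u y ∧ y 0 = y₀ ∧ ‖y T - yf‖ < ε

/-- Finite-approximate controllability on `[0, T]` of `y' = A y + B u + N(t, y)` with respect to
the finite-dimensional subspace `M`. -/
def FiniteApproximatelyControllable (S : C0Semigroup 𝕜 X) (B : U →L[𝕜] X) (N : ℝ → X → X)
    (T : ℝ) (M : Submodule 𝕜 X) [FiniteDimensional 𝕜 M] : Prop :=
  ∀ y₀ yf : X, ∀ ε : ℝ, 0 < ε →
    ∃ (u : ℝ → U) (y : ℝ → X), MemLp u 2 (volume.restrict (Icc 0 T)) ∧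
      IsMildSolution S B N T y₀ u y ∧ y 0 = y₀ ∧ ‖y T - yf‖ < ε ∧
      M.starProjection (y T) = M.starProjection yf

end

section

variable (𝕜 : Type*) {X : Type*} [RCLike 𝕜] [NormedAddCommGroup X] [InnerProductSpace 𝕜 X]

/-- `f` is continuous on `[0, T] × X` and has a Fréchet derivative in the state variable which is
continuous (into the bounded operators with the operator norm) and uniformly bounded there. -/
def HasBoundedC1State (f : ℝ → X → X) (T : ℝ) : Prop :=
  ContinuousOn (fun p : ℝ × X => f p.1 p.2) (Icc 0 T ×ˢ univ) ∧
    (∀ t ∈ Icc (0 : ℝ) T, Differentiable 𝕜 (f t)) ∧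
    ContinuousOn (fun p : ℝ × X => fderiv 𝕜 (f p.1) p.2) (Icc 0 T ×ˢ univ) ∧
    ∃ L : ℝ, 0 < L ∧ ∀ t ∈ Icc (0 : ℝ) T, ∀ z : X, ‖fderiv 𝕜 (f t) z‖ ≤ L

end

/-- `g` is continuous on `[0, T] × X` and `‖g(t, z)‖ ≤ m(t)` for a continuous `m ≥ 0`. -/
def IsContinuousDominated {X : Type*} [NormedAddCommGroup X] (g : ℝ → X → X) (T : ℝ) : Prop :=
  ContinuousOn (fun p : ℝ × X => g p.1 p.2) (Icc 0 T ×ˢ univ) ∧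
    ∃ m : ℝ → ℝ, ContinuousOn m (Icc 0 T) ∧ (∀ t ∈ Icc (0 : ℝ) T, 0 ≤ m t) ∧
      ∀ t ∈ Icc (0 : ℝ) T, ∀ z : X, ‖g t z‖ ≤ m t

/-! Controllability of every linear perturbation makes controls almost as rich as arbitrary forcing,
so the nonlinear term can be cancelled up to a small error. Pass to the rescaled semigroup `exp (-c
t) S t`. If its integrals with integrand `B u` could not approach the integral over `[0, T]` with
some constant integrand `x`, Hilbert space duality would give a functional `P` in the domain of the
adjoint generator with `P ∘ B = 0` and `P x ≠ 0`. A constant rank one feedback then forces `P (y T)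
= 0` for every trajectory from `0`, contradicting (AC) (`exists_norm_conv_const_sub_lt`). Hence
constant controls imitate constant forcing at time `T`. For `c` with rescaled norm at most `1/2` at
time `T`, this holds uniformly on `[0, T]`, and step functions extend it to all continuous forcing
(`isTrackable_of_approximatelyControllable`). Now let `z` be a linear trajectory ending near `yf`,
driven by `u₀`. For a bounded nonlinearity `N`, compactness of the semigroup makes the responses to
`N y` relatively compact, so a finite partition of unity yields a feedback `R y` whose response is
uniformly close to that of `N y`. The control `u₀ - R y`, corrected through a right inverse of the
projected terminal map so that the `M`-component is exact, defines a closed loop with a Schauder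
fixed point (`exists_control_of_bounded`). Its distance to `z` is bounded independently of the size
of `N`. So `f + g` may be truncated outside the ball of radius `‖z‖ + 1`: the trajectory found never
leaves that ball and solves the original equation. -/

section Brouwer

/-! ### Brouwer's theorem, by the volume polynomial argument. -/

variable {E : Type*} [NormedAddCommGroup E] [InnerProductSpace ℝ E]

/-- A function that is Lipschitz on a ball and vanishes on its boundary sphere stays Lipschitz when
extended by zero. -/
theorem lipschitzWith_indicator_closedBall {h : E → E} {R : ℝ} {C : NNReal}
    (hh : LipschitzOnWith C h (Metric.closedBall 0 R)) (h0 : ∀ x, ‖x‖ = R → h x = 0) :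
    LipschitzWith C ((Metric.closedBall (0 : E) R).indicator h) := by
  have key : ∀ x y : E, ‖x‖ ≤ R → R < ‖y‖ → ‖h x‖ ≤ C * ‖x - y‖ := by
    intro x y hx hy
    -- The segment from `x` to `y` crosses the sphere, where `h` vanishes, at a point no farther
    -- from `x` than `y` is.
    have hc : ContinuousOn (fun s : ℝ => ‖x + s • (y - x)‖) (Icc 0 1) := by fun_prop
    obtain ⟨s, hs, hsR⟩ := intermediate_value_Icc (zero_le_one' ℝ) hc
      (show R ∈ Icc _ _ by simp [hx, hy.le])
    have hd := hh.dist_le_mul x (by simpa using hx) (x + s • (y - x))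
      (by simpa using (le_of_eq hsR))
    rw [h0 _ hsR, dist_zero_right, dist_eq_norm] at hd
    refine hd.trans (mul_le_mul_of_nonneg_left ?_ C.2)
    rw [sub_add_cancel_left, norm_neg, norm_smul, Real.norm_of_nonneg hs.1, norm_sub_rev x y]
    exact mul_le_of_le_one_left (norm_nonneg _) hs.2
  refine LipschitzWith.of_dist_le_mul fun x y => ?_
  by_cases hx : x ∈ Metric.closedBall (0 : E) R <;> by_cases hy : y ∈ Metric.closedBall (0 : E) R
  · simpa [indicator_of_mem hx, indicator_of_mem hy] using hh.dist_le_mul x hx y hy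
  · rw [indicator_of_mem hx, indicator_of_notMem hy, dist_zero_right, dist_eq_norm]
    exact key x y (by simpa using hx) (by simpa using hy)
  · rw [indicator_of_notMem hx, indicator_of_mem hy, dist_zero_left, dist_comm, dist_eq_norm]
    exact key y x (by simpa using hy) (by simpa using hx)
  · rw [indicator_of_notMem hx, indicator_of_notMem hy, dist_self]
    positivity

variable [FiniteDimensional ℝ E]

/-- `det (1 + t L)` is a polynomial in `t` of degree at most the dimension. -/
theorem exists_polynomial_eval_eq_det_one_add_smul (L : E →L[ℝ] E) :
    ∃ p : Polynomial ℝ, p.natDegree ≤ Module.finrank ℝ E ∧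
      ∀ t : ℝ, p.eval t = (1 + t • L : E →L[ℝ] E).det := by
  let b := Module.finBasis ℝ E
  let A := LinearMap.toMatrix b b (L : E →ₗ[ℝ] E)
  refine ⟨Matrix.det ((Polynomial.X : Polynomial ℝ) • A.map Polynomial.C +
    (1 : Matrix _ _ ℝ).map Polynomial.C), ?_, fun t => ?_⟩
  · simpa using Polynomial.natDegree_det_X_add_C_le A 1
  · rw [← Polynomial.coe_evalRingHom, RingHom.map_det, ContinuousLinearMap.det,
      ← LinearMap.det_toMatrix b]
    congr 1
    have hM : LinearMap.toMatrix b b ((1 + t • L : E →L[ℝ] E) : E →ₗ[ℝ] E) = 1 + t • A := by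
      rw [← LinearMap.toMatrix_id b, ← map_smul, ← map_add]
      rfl
    rw [hM]
    ext i j
    by_cases h : i = j <;> simp [h, A, add_comm] <;> exact mul_comm _ _

/-- For `s ∈ [0, 1]` the operator `1 + s L` is injective, so its determinant never vanishes along
the path from `1`, where it equals `1`. -/
theorem det_one_add_pos_of_norm_lt_one (L : E →L[ℝ] E) (hL : ‖L‖ < 1) :
    0 < (1 + L : E →L[ℝ] E).det := by
  obtain ⟨p, -, hp⟩ := exists_polynomial_eval_eq_det_one_add_smul L
  have hne : ∀ s ∈ Icc (0 : ℝ) 1, p.eval s ≠ 0 := by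
    intro s hs h0
    rw [hp] at h0
    obtain ⟨x, hx, hx0⟩ := SetLike.exists_of_lt (LinearMap.bot_lt_ker_of_det_eq_zero h0)
    have hx1 : x + s • L x = 0 := by simpa using hx
    have hx2 : x ≠ 0 := by simpa using hx0
    have h1 : ‖x‖ = s * ‖L x‖ := by
      have := congrArg norm (eq_neg_of_add_eq_zero_left hx1)
      rwa [norm_neg, norm_smul, Real.norm_of_nonneg hs.1] at this
    have h2 := L.le_opNorm x
    have h3 : 0 < ‖x‖ := norm_pos_iff.2 hx2
    nlinarith [hs.1, hs.2, norm_nonneg (L x)]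
  by_contra hcon
  have h1 : p.eval 1 ≤ 0 := by rw [hp, one_smul]; exact not_lt.1 hcon
  have h0 : p.eval 0 = 1 := by rw [hp, zero_smul, add_zero]; simp [ContinuousLinearMap.det]
  obtain ⟨s, hs, hs0⟩ := intermediate_value_Icc' (zero_le_one' ℝ) p.continuous.continuousOn
    (show (0 : ℝ) ∈ Icc (p.eval 1) (p.eval 0) from ⟨h1, by rw [h0]; exact zero_le_one⟩)
  exact hne s hs hs0

/-- A small Lipschitz perturbation of the identity supported in a ball maps the ball onto itself. -/
theorem bijOn_closedBall_add_of_lipschitz {h : E → E} {R : ℝ} {C : NNReal} (hC : C < 1)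
    (hh : LipschitzOnWith C h (Metric.closedBall 0 R)) (h0 : ∀ x, ‖x‖ = R → h x = 0) :
    BijOn (fun x => x + h x) (Metric.closedBall 0 R) (Metric.closedBall 0 R) := by
  set B := Metric.closedBall (0 : E) R
  let H : E → E := fun x => x + B.indicator h x
  have hl := lipschitzWith_indicator_closedBall hh h0
  have hA : ApproximatesLinearOn H (ContinuousLinearEquiv.refl ℝ E : E →L[ℝ] E) univ C := by
    intro x _ y _
    have := hl.dist_le_mul x y
    rw [dist_eq_norm, dist_eq_norm] at this
    have e : H x - H y - (x - y) = B.indicator h x - B.indicator h y := by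
      simp only [H]; abel
    change ‖H x - H y - (x - y)‖ ≤ _
    rwa [e]
  have hc : Subsingleton E ∨ C < ‖((ContinuousLinearEquiv.refl ℝ E).symm : E →L[ℝ] E)‖₊⁻¹ := by
    rcases subsingleton_or_nontrivial E with hE | hE
    · exact Or.inl hE
    · right
      have : ‖((ContinuousLinearEquiv.refl ℝ E).symm : E →L[ℝ] E)‖₊ = 1 := by
        ext; exact ContinuousLinearMap.norm_id
      rw [this]; simpa using hC
  have hinj : Function.Injective H := injOn_univ.1 (hA.injOn hc)
  have hsurj := hA.surjective hc
  have heq : EqOn H (fun x => x + h x) B := fun x hx => by simp [H, indicator_of_mem hx]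
  refine BijOn.congr ⟨fun x hx => ?_, hinj.injOn, fun y hy => ?_⟩ heq
  -- `H` is the identity outside the ball, so an image point outside is fixed; injectivity then says
  -- it is its own preimage. Surjectivity onto the ball is similar.
  · by_contra hcon
    have : H (H x) = H x := by simp [H, indicator_of_notMem hcon]
    rw [hinj this] at hcon
    exact hcon hx
  · obtain ⟨x, rfl⟩ := hsurj y
    refine ⟨x, ?_, rfl⟩
    by_contra hcon
    have : H x = x := by simp [H, indicator_of_notMem hcon]
    rw [this] at hy
    exact hcon hy

/-- There is no `C¹` retraction of a ball onto its boundary sphere. -/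
theorem not_exists_contDiff_retraction {G : E → E} (hG : ContDiff ℝ 1 G) {R : ℝ} (hR : 0 < R)
    (hid : ∀ x, ‖x‖ = R → G x = x) (hsph : ∀ x, ‖G x‖ = R) : False := by
  let _ : MeasurableSpace E := borel E
  have : BorelSpace E := ⟨rfl⟩
  set B := Metric.closedBall (0 : E) R with hB
  have hBc : IsCompact B := isCompact_closedBall _ _
  let h : E → E := fun x => G x - x
  have hhd : ContDiff ℝ 1 h := hG.sub contDiff_id
  have hDc : Continuous (fderiv ℝ h) := hhd.continuous_fderiv one_ne_zero
  obtain ⟨C, hC⟩ := hBc.exists_bound_of_continuousOn hDc.continuousOn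
  have hC0 : 0 ≤ C := (norm_nonneg _).trans (hC 0 (by simp [hB, hR.le]))
  have hlip : LipschitzOnWith C.toNNReal h B :=
    (convex_closedBall (0 : E) R).lipschitzOnWith_of_nnnorm_fderiv_le
      (fun x _ => (hhd.differentiable one_ne_zero) x) (fun x hx => by
        rw [← NNReal.coe_le_coe, coe_nnnorm, Real.coe_toNNReal C hC0]; exact hC x hx)
  have hint : ∀ t : ℝ, IntegrableOn (fun x => (1 + t • fderiv ℝ h x : E →L[ℝ] E).det) B
      volume := fun t =>
    (ContinuousLinearMap.continuous_det.comp
      (continuous_const.add (hDc.const_smul t))).continuousOn.integrableOn_compact hBc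
  -- For small `t` the map `x + t h(x)` permutes the ball and has positive Jacobian, so the change
  -- of variables formula gives the full volume.
  have hvol : ∀ t : ℝ, 0 ≤ t → t * C < 1 →
      ∫ x in B, (1 + t • fderiv ℝ h x : E →L[ℝ] E).det = volume.real B := by
    intro t ht htC
    have hlt : LipschitzOnWith (t * C).toNNReal (fun x => t • h x) B := by
      refine LipschitzOnWith.of_dist_le_mul fun x hx y hy => ?_
      have := hlip.dist_le_mul x hx y hy
      rw [Real.coe_toNNReal C hC0] at this
      rw [dist_smul₀, Real.norm_of_nonneg ht, Real.coe_toNNReal _ (by positivity), mul_assoc]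
      exact mul_le_mul_of_nonneg_left this ht
    have hb : BijOn (fun x => x + t • h x) B B :=
      bijOn_closedBall_add_of_lipschitz (by
        rw [← NNReal.coe_lt_coe, Real.coe_toNNReal _ (by positivity)]; simpa using htC) hlt
        (fun x hx => by simp [h, hid x hx])
    have hderiv : ∀ x ∈ B, HasFDerivWithinAt (fun x => x + t • h x)
        (1 + t • fderiv ℝ h x : E →L[ℝ] E) B x := fun x _ =>
      ((hasFDerivAt_id x).add
        (((hhd.differentiable one_ne_zero) x).hasFDerivAt.const_smul t)).hasFDerivWithinAt
    have := integral_image_eq_integral_abs_det_fderiv_smul volume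
      (Metric.isClosed_closedBall.measurableSet) hderiv hb.injOn (fun _ => (1 : ℝ))
    rw [hb.image_eq] at this
    simp only [integral_const, smul_eq_mul, mul_one, measureReal_restrict_apply_univ] at this
    rw [this]
    refine setIntegral_congr_fun Metric.isClosed_closedBall.measurableSet fun x hx => ?_
    refine (abs_of_pos (det_one_add_pos_of_norm_lt_one _ ?_)).symm
    rw [norm_smul, Real.norm_of_nonneg ht]
    exact (mul_le_mul_of_nonneg_left (hC x hx) ht).trans_lt htC
  have hdet0 : ∀ x, (1 + (1 : ℝ) • fderiv ℝ h x : E →L[ℝ] E).det = 0 := by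
    intro x
    have hGx : HasFDerivAt G (fderiv ℝ G x) x := ((hG.differentiable one_ne_zero) x).hasFDerivAt
    have hsum : (1 + (1 : ℝ) • fderiv ℝ h x : E →L[ℝ] E) = fderiv ℝ G x := by
      have : fderiv ℝ h x = fderiv ℝ G x - 1 := (hGx.sub (hasFDerivAt_id x)).fderiv
      rw [this, one_smul, add_sub_cancel]
    rw [hsum]
    -- `‖G‖` is constant, so the range of the derivative is orthogonal to `G x ≠ 0`; hence the
    -- derivative is singular.
    have horth : ∀ v, inner ℝ (G x) (fderiv ℝ G x v) = 0 := by
      intro v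
      have h1 := hGx.norm_sq
      have h2 : HasFDerivAt (fun x => ‖G x‖ ^ 2) (0 : E →L[ℝ] ℝ) x := by
        simp only [hsph]; exact hasFDerivAt_const _ _
      have := congrArg (fun L : E →L[ℝ] ℝ => L v) (h1.unique h2)
      simpa using this
    by_contra hne
    have hu : IsUnit (fderiv ℝ G x : E →ₗ[ℝ] E) :=
      (LinearMap.isUnit_iff_isUnit_det _).2 (isUnit_iff_ne_zero.2 hne)
    have hs : Function.Surjective (fderiv ℝ G x) := ((Module.End.isUnit_iff _).1 hu).2
    obtain ⟨v, hv⟩ := hs (G x)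
    have := horth v
    rw [hv, inner_self_eq_zero] at this
    have h3 := hsph x
    rw [this, norm_zero] at h3
    exact hR.ne h3
  -- The determinant has degree at most `n` in `t`, so its value at `t = 1` is determined by `n + 1`
  -- distinct nodes. The nodes `δ / (i + 1)` all lie where `hvol` applies, which carries the volume
  -- identity to `t = 1`, where the determinant is `0`.
  let n := Module.finrank ℝ E
  let δ : ℝ := 1 / (C + 1)
  let v : ℕ → ℝ := fun i => δ / (i + 1)
  have hδ : 0 < δ := by positivity
  have hv0 : ∀ i, 0 ≤ v i := fun i => by positivity
  have hvC : ∀ i, v i * C < 1 := by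
    intro i
    have h1 : v i ≤ δ := div_le_self hδ.le (by linarith [(Nat.cast_nonneg i : (0 : ℝ) ≤ i)])
    have h2 : δ * C < 1 := by
      simp only [δ]; rw [one_div, inv_mul_lt_one₀ (by positivity)]; linarith
    exact (mul_le_mul_of_nonneg_right h1 hC0).trans_lt h2
  have hvinj : Set.InjOn v (Finset.range (n + 1) : Set ℕ) := by
    intro i _ j _ hij
    simp only [v] at hij
    have hi : (0 : ℝ) < i + 1 := by positivity
    have hj : (0 : ℝ) < j + 1 := by positivity
    rw [div_eq_div_iff hi.ne' hj.ne'] at hij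
    have := mul_left_cancel₀ hδ.ne' hij
    exact_mod_cast (add_right_cancel this).symm
  have hinterp : ∀ x, (1 + (1 : ℝ) • fderiv ℝ h x : E →L[ℝ] E).det =
      ∑ i ∈ Finset.range (n + 1), (1 + v i • fderiv ℝ h x : E →L[ℝ] E).det *
        (Lagrange.basis (Finset.range (n + 1)) v i).eval 1 := by
    intro x
    obtain ⟨p, hp, hpe⟩ := exists_polynomial_eval_eq_det_one_add_smul (fderiv ℝ h x)
    rw [← hpe 1]
    conv_lhs => rw [Lagrange.eq_interpolate (f := p) hvinj (by
      refine (Polynomial.degree_le_natDegree).trans_lt ?_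
      rw [Finset.card_range]
      exact_mod_cast Nat.lt_succ_of_le hp)]
    simp [Lagrange.interpolate_apply, Polynomial.eval_finsetSum, hpe]
  have h1 : ∫ x in B, (1 + (1 : ℝ) • fderiv ℝ h x : E →L[ℝ] E).det = volume.real B := by
    simp_rw [hinterp]
    rw [integral_finsetSum _ (fun i _ => (hint (v i)).mul_const _)]
    simp_rw [integral_mul_const]
    rw [Finset.sum_congr rfl (fun i _ => by rw [hvol (v i) (hv0 i) (hvC i)]), ← Finset.mul_sum,
      ← Polynomial.eval_finsetSum, Lagrange.sum_basis hvinj (by simp), Polynomial.eval_one, mul_one]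
  simp_rw [hdet0] at h1
  simp only [integral_zero] at h1
  have hpos : 0 < volume.real B :=
    ENNReal.toReal_pos (Metric.measure_closedBall_pos _ _ hR).ne' hBc.measure_lt_top.ne
  exact hpos.ne h1

/-- Cut `φ` off between radii `r` and `2r`. Without a fixed point, `x - χ(x) φ(x)` never vanishes
and is the identity on the sphere of radius `2r`, so rescaling it to norm `2r` gives a forbidden
retraction. -/
theorem exists_fixedPoint_of_contDiff_of_bounded {φ : E → E} (hφ : ContDiff ℝ 1 φ) {r : ℝ}
    (hr : 0 < r) (hb : ∀ x, ‖φ x‖ ≤ r) : ∃ x, φ x = x := by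
  by_contra! hne
  let χ : ContDiffBump (0 : E) := ⟨r, 2 * r, hr, by linarith⟩
  let F : E → E := fun x => x - χ x • φ x
  have hF : ContDiff ℝ 1 F := contDiff_id.sub (χ.contDiff.smul hφ)
  have hF0 : ∀ x, F x ≠ 0 := by
    intro x hx
    have hx' : x = χ x • φ x := sub_eq_zero.1 hx
    have hxr : ‖x‖ ≤ r := by
      rw [hx', norm_smul, Real.norm_of_nonneg χ.nonneg]
      exact (mul_le_of_le_one_left (norm_nonneg _) χ.le_one).trans (hb x)
    rw [χ.one_of_mem_closedBall (by simpa [χ] using hxr), one_smul] at hx'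
    exact hne x hx'.symm
  refine not_exists_contDiff_retraction (G := fun x => (2 * r * ‖F x‖⁻¹) • F x) ?_
    (show 0 < 2 * r by linarith) (fun x hx => ?_) (fun x => ?_)
  · exact (contDiff_const.mul ((hF.norm ℝ hF0).inv fun x => norm_ne_zero_iff.2 (hF0 x))).smul hF
  · have : F x = x := by
      simp only [F]
      rw [χ.zero_of_le_dist (by simp [χ, hx]), zero_smul, sub_zero]
    simp only [this, hx]
    rw [mul_inv_cancel₀ (by linarith), one_smul]
  · rw [norm_smul, norm_mul, norm_inv, norm_norm, mul_assoc,
      inv_mul_cancel₀ (norm_ne_zero_iff.2 (hF0 x)), mul_one, Real.norm_of_nonneg (by linarith)]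

/-- **Brouwer's fixed point theorem** for bounded continuous self-maps of a Euclidean space. -/
theorem exists_fixedPoint_of_continuous_of_bounded {φ : E → E} (hφ : Continuous φ) {r : ℝ}
    (hb : ∀ x, ‖φ x‖ ≤ r) : ∃ x, φ x = x := by
  have hr : 0 ≤ r := (norm_nonneg _).trans (hb 0)
  have hex : ∀ k : ℕ, ∃ x, dist x (φ x) < 1 / ((k : ℝ) + 1) := by
    intro k
    have hk : (0 : ℝ) < 1 / ((k : ℝ) + 1) := by positivity
    obtain ⟨ψ, hψ, hd, -⟩ := hφ.exists_contDiff_approx 1 (continuous_const (y := 1 / ((k : ℝ) + 1)))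
      (fun _ => hk)
    obtain ⟨x, hx⟩ := exists_fixedPoint_of_contDiff_of_bounded hψ (r := r + 1 / ((k : ℝ) + 1))
      (by positivity) (fun x => by
        have h1 := norm_le_norm_add_norm_sub (φ x) (ψ x)
        have h2 := hd x
        rw [dist_comm, dist_eq_norm] at h2
        linarith [hb x, norm_sub_rev (φ x) (ψ x), norm_sub_rev (ψ x) (φ x)])
    exact ⟨x, by simpa [hx] using hd x⟩
  choose x hx using hex
  have hmem : ∀ k, x k ∈ Metric.closedBall (0 : E) (r + 1) := by
    intro k
    have h1 : (1 : ℝ) / ((k : ℝ) + 1) ≤ 1 :=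
      (div_le_one (by positivity)).2 (by linarith [(Nat.cast_nonneg k : (0 : ℝ) ≤ k)])
    have h2 := hx k
    have h3 := dist_triangle (x k) (φ (x k)) 0
    rw [dist_zero_right (φ (x k))] at h3
    rw [Metric.mem_closedBall]
    linarith [hb (x k)]
  obtain ⟨p, -, s, hs, hlim⟩ := (isCompact_closedBall (0 : E) (r + 1)).tendsto_subseq hmem
  refine ⟨p, ?_⟩
  have h1 : Tendsto (fun k => dist (x (s k)) (φ (x (s k)))) atTop (𝓝 (dist p (φ p))) :=
    hlim.dist ((hφ.tendsto p).comp hlim)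
  have h2 : Tendsto (fun k => dist (x (s k)) (φ (x (s k)))) atTop (𝓝 0) :=
    squeeze_zero (fun _ => dist_nonneg) (fun k => (hx (s k)).le)
      (tendsto_one_div_add_atTop_nhds_zero_nat.comp hs.tendsto_atTop)
  exact (dist_eq_zero.1 (tendsto_nhds_unique h1 h2)).symm

end Brouwer

/-! ### Schauder's theorem, by finite-dimensional approximation. -/

/-- A continuous map into a totally bounded set admits a continuous partition of unity subordinate
to a finite net of the set. -/
theorem exists_finite_partition_of_totallyBounded {Y E : Type*} [TopologicalSpace Y]
    [PseudoMetricSpace E] {K : Set E} (hK : TotallyBounded K) {Φ : Y → E} (hΦ : Continuous Φ)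
    (hΦK : ∀ y, Φ y ∈ K) {ε : ℝ} (hε : 0 < ε) :
    ∃ (t : Finset E) (w : t → Y → ℝ), (∀ i : t, (i : E) ∈ K) ∧ (∀ i, Continuous (w i)) ∧
      (∀ i y, 0 ≤ w i y) ∧ (∀ y, ∑ i, w i y = 1) ∧ ∀ i y, w i y ≠ 0 → dist (Φ y) i < ε := by
  obtain ⟨t, htK, htf, hcov⟩ := Metric.finite_approx_of_totallyBounded hK ε hε
  lift t to Finset E using htf
  let v : t → Y → ℝ := fun i y => max 0 (ε - dist (Φ y) i)
  have hv0 : ∀ i y, 0 ≤ v i y := fun i y => le_max_left _ _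
  have hvc : ∀ i, Continuous (v i) := fun i => by fun_prop
  have hs : ∀ y, 0 < ∑ i, v i y := by
    intro y
    obtain ⟨x, hx, hd⟩ := mem_iUnion₂.1 (hcov (hΦK y))
    exact Finset.sum_pos' (fun i _ => hv0 i y)
      ⟨⟨x, hx⟩, Finset.mem_univ _, lt_max_of_lt_right (sub_pos.2 hd)⟩
  refine ⟨t, fun i y => v i y / ∑ j, v j y, fun i => htK i.2, fun i => ?_, fun i y => ?_,
    fun y => ?_, fun i y hi => ?_⟩
  · exact (hvc i).div (continuous_finsetSum _ fun j _ => hvc j) fun y => (hs y).ne'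
  · exact div_nonneg (hv0 i y) (hs y).le
  · rw [← Finset.sum_div, div_self (hs y).ne']
  · by_contra hcon
    refine hi ?_
    simp only [v]
    rw [max_eq_left (by linarith [not_lt.1 hcon]), zero_div]

/-- A convex combination of points near `p` is near `p`. -/
theorem norm_sum_smul_sub_le {ι E : Type*} [Fintype ι] [SeminormedAddCommGroup E] [NormedSpace ℝ E]
    {w : ι → ℝ} (h0 : ∀ i, 0 ≤ w i) (h1 : ∑ i, w i = 1) {x : ι → E} {p : E} {ε : ℝ}
    (hx : ∀ i, w i ≠ 0 → ‖x i - p‖ ≤ ε) : ‖∑ i, w i • x i - p‖ ≤ ε := by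
  have e : ∑ i, w i • x i - p = ∑ i, w i • (x i - p) := by
    simp_rw [smul_sub]
    rw [Finset.sum_sub_distrib, ← Finset.sum_smul, h1, one_smul]
  rw [e]
  calc ‖∑ i, w i • (x i - p)‖ ≤ ∑ i, w i * ε := by
        refine norm_sum_le_of_le _ fun i _ => ?_
        rw [norm_smul, Real.norm_of_nonneg (h0 i)]
        by_cases hi : w i = 0
        · simp [hi]
        · exact mul_le_mul_of_nonneg_left (hx i hi) (h0 i)
    _ = ε := by rw [← Finset.sum_mul, h1, one_mul]

/-- **Schauder's fixed point theorem** for continuous maps with values in a compact set. -/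
theorem exists_fixedPoint_of_continuous_of_mem_compact {E : Type*} [NormedAddCommGroup E]
    [NormedSpace ℝ E] {K : Set E} (hK : IsCompact K) {Φ : E → E} (hΦ : Continuous Φ)
    (hΦK : ∀ x, Φ x ∈ K) : ∃ x, Φ x = x := by
  have hex : ∀ k : ℕ, ∃ x, dist x (Φ x) ≤ 1 / ((k : ℝ) + 1) := by
    intro k
    obtain ⟨t, w, -, hwc, hw0, hw1, hwd⟩ := exists_finite_partition_of_totallyBounded
      hK.totallyBounded hΦ hΦK (show (0 : ℝ) < 1 / ((k : ℝ) + 1) by positivity)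
    -- Brouwer is applied to the weights: if `a i = w i (pt a)` for all `i`, then `pt a` is a convex
    -- combination of net points near `Φ (pt a)`.
    let pt : EuclideanSpace ℝ t → E := fun a => ∑ i : t, a i • (i : E)
    have hpt : Continuous pt := continuous_finsetSum _ fun i _ =>
      (EuclideanSpace.proj i).continuous.smul continuous_const
    let φ : EuclideanSpace ℝ t → EuclideanSpace ℝ t := fun a => WithLp.toLp 2 fun i => w i (pt a)
    have hφ : Continuous φ :=
      (PiLp.continuous_toLp 2 _).comp (continuous_pi fun i => (hwc i).comp hpt)
    have hb : ∀ a, ‖φ a‖ ≤ 1 := by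
      intro a
      rw [EuclideanSpace.norm_eq]
      refine Real.sqrt_le_iff.2 ⟨zero_le_one, ?_⟩
      rw [one_pow]
      calc ∑ i, ‖φ a i‖ ^ 2 ≤ ∑ i, w i (pt a) := by
            refine Finset.sum_le_sum fun i _ => ?_
            have hle : w i (pt a) ≤ 1 := by
              rw [← hw1 (pt a)]
              exact Finset.single_le_sum (f := fun j => w j (pt a)) (fun j _ => hw0 j _)
                (Finset.mem_univ i)
            simp only [φ, Real.norm_eq_abs, sq_abs]
            nlinarith [hw0 i (pt a)]
        _ = 1 := hw1 _
    obtain ⟨a, ha⟩ := exists_fixedPoint_of_continuous_of_bounded hφ hb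
    refine ⟨pt a, ?_⟩
    have hai : ∀ i, a i = w i (pt a) := fun i => by
      conv_lhs => rw [← ha]
    have := norm_sum_smul_sub_le (fun i => hw0 i (pt a)) (hw1 (pt a)) (x := fun i : t => (i : E))
      (p := Φ (pt a)) (ε := 1 / ((k : ℝ) + 1)) (fun i hi => by
        rw [← dist_eq_norm, dist_comm]; exact (hwd i _ hi).le)
    simp_rw [← hai] at this
    rwa [dist_eq_norm]
  choose x hx using hex
  obtain ⟨p, -, s, hs, hlim⟩ := hK.tendsto_subseq fun k => hΦK (x k)
  have h2 : Tendsto (fun k => dist (x (s k)) (Φ (x (s k)))) atTop (𝓝 0) :=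
    squeeze_zero (fun _ => dist_nonneg) (fun k => hx (s k))
      (tendsto_one_div_add_atTop_nhds_zero_nat.comp hs.tendsto_atTop)
  have hlim' : Tendsto (fun k => x (s k)) atTop (𝓝 p) :=
    (tendsto_iff_of_dist h2).2 hlim
  exact ⟨p, tendsto_nhds_unique ((hΦ.tendsto p).comp hlim') hlim⟩

theorem integrableOn_IccExtend {X : Type*} [NormedAddCommGroup X] {T : ℝ} (hT : 0 ≤ T)
    (k : C(Icc (0 : ℝ) T, X)) : IntegrableOn (IccExtend hT k) (Icc 0 T) :=
  k.continuous.Icc_extend'.continuousOn.integrableOn_compact isCompact_Icc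

/-! ### Convolution with a semigroup, and its compactness. -/

namespace C0Semigroup

variable {𝕜 X : Type*} [RCLike 𝕜] [NormedAddCommGroup X] [InnerProductSpace 𝕜 X]

section Bounds

variable [CompleteSpace X] (S : C0Semigroup 𝕜 X)

theorem exists_norm_le (T : ℝ) : ∃ C : ℝ, 0 ≤ C ∧ ∀ t ∈ Icc (0 : ℝ) T, ‖S t‖ ≤ C := by
  obtain ⟨C, hC⟩ := banach_steinhaus (g := fun t : Icc (0 : ℝ) T => S t) fun x => by
    obtain ⟨D, hD⟩ := isCompact_Icc.exists_bound_of_continuousOn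
      ((S.strong_continuity x).mono (Icc_subset_Ici_self : Icc (0 : ℝ) T ⊆ _))
    exact ⟨D, fun t => hD t t.2⟩
  exact ⟨max C 0, le_max_right _ _, fun t ht => (hC ⟨t, ht⟩).trans (le_max_left _ _)⟩

/-- Joint continuity of `(t, x) ↦ S t x`, with time clamped to `[0, ∞)`. -/
theorem continuous_uncurry : Continuous fun p : ℝ × X => S (max p.1 0) p.2 := by
  refine continuous_iff_continuousAt.2 fun ⟨t₀, x₀⟩ => ?_
  obtain ⟨C, hC0, hC⟩ := S.exists_norm_le (|t₀| + 1)
  have h1 : Tendsto (fun p : ℝ × X => S (max p.1 0) (p.2 - x₀)) (𝓝 (t₀, x₀)) (𝓝 0) := by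
    refine squeeze_zero_norm' (a := fun p : ℝ × X => C * ‖p.2 - x₀‖) ?_ ?_
    · have : ∀ᶠ p : ℝ × X in 𝓝 (t₀, x₀), p.1 < |t₀| + 1 :=
        continuous_fst.continuousAt.eventually_lt continuousAt_const
          (by linarith [le_abs_self t₀])
      filter_upwards [this] with p hp
      refine (S _).le_of_opNorm_le (hC _ ⟨le_max_right _ _, max_le hp.le (by positivity)⟩) _
    · have : Continuous fun p : ℝ × X => C * ‖p.2 - x₀‖ := by fun_prop
      simpa using this.tendsto (t₀, x₀)
  have h2 : Continuous fun p : ℝ × X => S (max p.1 0) x₀ :=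
    (S.strong_continuity x₀).comp_continuous (by fun_prop) fun p => mem_Ici.2 (le_max_right _ _)
  have h3 := h1.add (h2.tendsto (t₀, x₀))
  simp only [zero_add] at h3
  refine h3.congr fun p => ?_
  rw [← _root_.map_add, sub_add_cancel]

theorem aestronglyMeasurable_apply {μ : Measure ℝ} {k : ℝ → X} (hk : AEStronglyMeasurable k μ)
    (t : ℝ) : AEStronglyMeasurable (fun s => S (max (t - s) 0) (k s)) μ :=
  S.continuous_uncurry.comp_aestronglyMeasurable
    (((continuous_const.sub continuous_id).aestronglyMeasurable).prodMk hk)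

/-- Strong continuity at `0` is uniform on compact sets. -/
theorem exists_forall_norm_sub_lt {Q : Set X} (hQ : _root_.IsCompact Q) {ε : ℝ} (hε : 0 < ε) :
    ∃ δ > 0, ∀ h, 0 ≤ h → h < δ → ∀ x ∈ Q, ‖S h x - x‖ < ε := by
  have : ∀ᶠ h : ℝ in 𝓝 0, ∀ x ∈ Q, ‖S (max h 0) x - x‖ < ε := by
    refine hQ.eventually_forall_of_forall_eventually fun x _ => ?_
    have hc : Continuous fun p : ℝ × X => ‖S (max p.1 0) p.2 - p.2‖ :=
      (S.continuous_uncurry.sub continuous_snd).norm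
    refine hc.continuousAt.eventually_lt continuousAt_const ?_
    simp [S.map_zero, hε]
  obtain ⟨δ, hδ, h⟩ := Metric.eventually_nhds_iff.1 this
  refine ⟨δ, hδ, fun t ht htδ x hx => ?_⟩
  have := h (y := t) (by rwa [Real.dist_eq, sub_zero, abs_of_nonneg ht]) x hx
  rwa [max_eq_left ht] at this

theorem intervalIntegrable_apply {T : ℝ} {k : ℝ → X} (hk : IntegrableOn k (Icc 0 T)) {a b t : ℝ}
    (ha : 0 ≤ a) (hab : a ≤ b) (hbt : b ≤ t) (htT : t ≤ T) :
    IntervalIntegrable (fun s => S (t - s) (k s)) volume a b := by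
  obtain ⟨C, hC0, hC⟩ := S.exists_norm_le T
  have hk' : IntegrableOn k (Ioc a b) := hk.mono_set fun s hs =>
    ⟨ha.trans hs.1.le, hs.2.trans (hbt.trans htT)⟩
  rw [intervalIntegrable_iff_integrableOn_Ioc_of_le hab]
  have heq : EqOn (fun s => S (max (t - s) 0) (k s)) (fun s => S (t - s) (k s)) (Ioc a b) :=
    fun s hs => by simp only [max_eq_left (sub_nonneg.2 (hs.2.trans hbt))]
  refine IntegrableOn.congr_fun ?_ heq measurableSet_Ioc
  refine Integrable.mono' (hk'.norm.const_mul C) (S.aestronglyMeasurable_apply hk'.1 t) ?_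
  refine (ae_restrict_iff' measurableSet_Ioc).2 (Eventually.of_forall fun s hs => ?_)
  refine (S _).le_of_opNorm_le (hC _ ⟨le_max_right _ _, max_le ?_ ?_⟩) _ <;>
    linarith [hs.1, hs.2]

end Bounds

variable [NormedSpace ℝ X] (S : C0Semigroup 𝕜 X)

/-- The convolution `t ↦ ∫₀ᵗ S (t - s) k(s) ds`. -/
noncomputable def conv (k : ℝ → X) (t : ℝ) : X := ∫ s in (0 : ℝ)..t, S (t - s) (k s)

theorem conv_zero (k : ℝ → X) : S.conv k 0 = 0 := intervalIntegral.integral_same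

theorem conv_smul (c : 𝕜) (k : ℝ → X) (t : ℝ) :
    S.conv (fun s => c • k s) t = c • S.conv k t := by
  simp only [conv, map_smul]
  exact intervalIntegral.integral_smul _ _

theorem norm_integral_apply_le {T C m : ℝ} (hC : ∀ t ∈ Icc (0 : ℝ) T, ‖S t‖ ≤ C) (hC0 : 0 ≤ C)
    {k : ℝ → X} (hk : ∀ s ∈ Ioc 0 T, ‖k s‖ ≤ m) {a t : ℝ} (ha : 0 ≤ a) (hat : a ≤ t)
    (htT : t ≤ T) : ‖∫ s in a..t, S (t - s) (k s)‖ ≤ C * m * (t - a) := by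
  rw [← abs_of_nonneg (sub_nonneg.2 hat)]
  refine intervalIntegral.norm_integral_le_of_norm_le_const fun s hs => ?_
  rw [uIoc_of_le hat] at hs
  refine ((S _).le_of_opNorm_le (hC _ ⟨?_, ?_⟩) _).trans
    (mul_le_mul_of_nonneg_left (hk s ⟨?_, ?_⟩) hC0) <;> linarith [hs.1, hs.2]

theorem norm_conv_le {T C m : ℝ} (hC : ∀ t ∈ Icc (0 : ℝ) T, ‖S t‖ ≤ C) (hC0 : 0 ≤ C)
    {k : ℝ → X} (hk : ∀ s ∈ Ioc 0 T, ‖k s‖ ≤ m) {t : ℝ} (ht : t ∈ Icc 0 T) :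
    ‖S.conv k t‖ ≤ C * m * t := by
  simpa [conv] using S.norm_integral_apply_le hC hC0 hk le_rfl ht.1 ht.2

variable [CompleteSpace X]

theorem conv_add {T : ℝ} {k l : ℝ → X} (hk : IntegrableOn k (Icc 0 T))
    (hl : IntegrableOn l (Icc 0 T)) {t : ℝ} (ht : t ∈ Icc 0 T) :
    S.conv (fun s => k s + l s) t = S.conv k t + S.conv l t := by
  simp only [conv, _root_.map_add]
  exact intervalIntegral.integral_add (S.intervalIntegrable_apply hk le_rfl ht.1 le_rfl ht.2)
    (S.intervalIntegrable_apply hl le_rfl ht.1 le_rfl ht.2)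

theorem conv_sub {T : ℝ} {k l : ℝ → X} (hk : IntegrableOn k (Icc 0 T))
    (hl : IntegrableOn l (Icc 0 T)) {t : ℝ} (ht : t ∈ Icc 0 T) :
    S.conv (fun s => k s - l s) t = S.conv k t - S.conv l t := by
  simp only [conv, map_sub]
  exact intervalIntegral.integral_sub (S.intervalIntegrable_apply hk le_rfl ht.1 le_rfl ht.2)
    (S.intervalIntegrable_apply hl le_rfl ht.1 le_rfl ht.2)

/-- Split the integral at `t` and factor out `S h`. Both halves of the Arzelà–Ascoli argument,
pointwise compactness and equicontinuity, rest on this. -/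
theorem conv_add_time {T : ℝ} {k : ℝ → X} (hk : IntegrableOn k (Icc 0 T)) {t h : ℝ} (ht : 0 ≤ t)
    (hh : 0 ≤ h) (hT : t + h ≤ T) :
    S.conv k (t + h) = S h (S.conv k t) + ∫ s in t..(t + h), S (t + h - s) (k s) := by
  have h1 := S.intervalIntegrable_apply hk le_rfl ht (show t ≤ t + h by linarith) hT
  have h2 := S.intervalIntegrable_apply hk ht (show t ≤ t + h by linarith) le_rfl hT
  rw [conv, ← intervalIntegral.integral_add_adjacent_intervals h1 h2, conv,
    ← ContinuousLinearMap.intervalIntegral_comp_comm _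
      (S.intervalIntegrable_apply hk le_rfl ht le_rfl (by linarith))]
  congr 1
  refine intervalIntegral.integral_congr fun s hs => ?_
  rw [uIcc_of_le ht] at hs
  rw [show t + h - s = h + (t - s) by ring, S.map_add _ _ hh (sub_nonneg.2 hs.2)]
  rfl

/-- Written over the fixed interval `(0, T]` with an indicator, the integrand is continuous in `t`
at `t₀` for every `s ≠ t₀`, so dominated convergence applies. -/
theorem continuousOn_conv {T : ℝ} {k : ℝ → X} (hk : IntegrableOn k (Icc 0 T)) :
    ContinuousOn (S.conv k) (Icc 0 T) := by
  obtain ⟨C, hC0, hC⟩ := S.exists_norm_le T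
  let F : ℝ → ℝ → X := fun t => (Iic t).indicator fun s => S (max (t - s) 0) (k s)
  have hF : ∀ t ∈ Icc (0 : ℝ) T, S.conv k t = ∫ s in Ioc 0 T, F t s := by
    intro t ht
    rw [setIntegral_indicator measurableSet_Iic, conv, intervalIntegral.integral_of_le ht.1]
    have hset : Ioc 0 T ∩ Iic t = Ioc 0 t := by
      ext s
      simp only [mem_inter_iff, mem_Ioc, mem_Iic]
      exact ⟨fun h => ⟨h.1.1, h.2⟩, fun h => ⟨⟨h.1, h.2.trans ht.2⟩, h.2⟩⟩
    rw [hset]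
    refine setIntegral_congr_fun measurableSet_Ioc fun s hs => ?_
    simp only [max_eq_left (sub_nonneg.2 hs.2)]
  refine ContinuousOn.congr (fun t₀ ht₀ => ?_) hF
  have hk' : IntegrableOn k (Ioc 0 T) := hk.mono_set Ioc_subset_Icc_self
  refine continuousWithinAt_of_dominated (bound := fun s => C * ‖k s‖) ?_ ?_
    (hk'.norm.const_mul C) ?_
  · exact Eventually.of_forall fun t =>
      (S.aestronglyMeasurable_apply hk'.1 t).indicator measurableSet_Iic
  · filter_upwards [self_mem_nhdsWithin] with t ht
    refine (ae_restrict_iff' measurableSet_Ioc).2 (Eventually.of_forall fun s hs => ?_)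
    refine (norm_indicator_le_norm_self _ _).trans ?_
    refine (S _).le_of_opNorm_le (hC _ ⟨le_max_right _ _, max_le ?_ ?_⟩) _
    · linarith [hs.1, ht.2]
    · exact ht.1.trans ht.2
  · have hne : ∀ᵐ s ∂(volume.restrict (Ioc 0 T)), s ≠ t₀ :=
      ae_restrict_of_ae (by simp [ae_iff, measure_singleton])
    filter_upwards [hne] with s hs
    refine ContinuousAt.continuousWithinAt ?_
    rcases lt_or_gt_of_ne hs with h | h
    · have hc : Continuous fun t => S (max (t - s) 0) (k s) :=
        S.continuous_uncurry.comp ((continuous_id.sub continuous_const).prodMk continuous_const)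
      refine hc.continuousAt.congr ?_
      filter_upwards [lt_mem_nhds h] with t ht
      simp [F, indicator_of_mem (mem_Iic.2 ht.le)]
    · refine (continuousAt_const (y := (0 : X))).congr ?_
      filter_upwards [gt_mem_nhds h] with t ht
      simp [F, indicator_of_notMem (fun h' => not_le.2 ht (mem_Iic.1 h'))]

section Compactness

variable {S}

/-- For a compact semigroup the values of all convolutions with integrands bounded by `m` form a
totally bounded set. -/
theorem totallyBounded_conv (hS : S.IsCompact) (T m : ℝ) (hm : 0 ≤ m) :
    TotallyBounded {x : X | ∃ k : ℝ → X, IntegrableOn k (Icc 0 T) ∧ (∀ s ∈ Ioc 0 T, ‖k s‖ ≤ m) ∧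
      ∃ t ∈ Icc 0 T, S.conv k t = x} := by
  obtain ⟨C, hC0, hC⟩ := S.exists_norm_le T
  refine Metric.totallyBounded_iff.2 fun ε hε => ?_
  -- The last `δ` units of time contribute less than `ε / 2`; the rest is `S δ` applied to a bounded
  -- vector, hence lies in a totally bounded set.
  obtain ⟨δ, hδ, hδε⟩ : ∃ δ > 0, C * m * δ < ε / 2 := by
    refine ⟨ε / 2 / (C * m + 1), by positivity, ?_⟩
    rw [mul_div_assoc', div_lt_iff₀ (by positivity)]
    nlinarith
  have hP : TotallyBounded (S δ '' Metric.closedBall 0 (C * m * T)) := by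
    exact ((hS δ hδ).isCompact_closure_image_closedBall _).totallyBounded.subset subset_closure
  obtain ⟨N, hN, hcov⟩ := Metric.totallyBounded_iff.1 hP (ε / 2) (by positivity)
  refine ⟨N, hN, ?_⟩
  rintro x ⟨k, hk, hkm, t, ht, rfl⟩
  have hT : 0 ≤ T := ht.1.trans ht.2
  obtain ⟨p, hp, hd⟩ : ∃ p ∈ S δ '' Metric.closedBall 0 (C * m * T),
      ‖S.conv k t - p‖ < ε / 2 := by
    rcases le_total δ t with h | h
    · refine ⟨S δ (S.conv k (t - δ)), ⟨_, ?_, rfl⟩, ?_⟩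
      · rw [mem_closedBall_zero_iff]
        refine (S.norm_conv_le hC hC0 hkm ⟨sub_nonneg.2 h, by linarith [ht.2]⟩).trans ?_
        exact mul_le_mul_of_nonneg_left (by linarith [ht.2]) (by positivity)
      · have h1 := S.conv_add_time hk (sub_nonneg.2 h) hδ.le (by linarith [ht.2])
        have h2 := S.norm_integral_apply_le hC hC0 hkm (sub_nonneg.2 h) (by linarith) ht.2
        rw [sub_add_cancel] at h1
        rw [h1, add_sub_cancel_left]
        refine h2.trans_lt ?_
        rwa [sub_sub_cancel]
    · refine ⟨S δ 0, ⟨0, Metric.mem_closedBall_self (by positivity), rfl⟩, ?_⟩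
      rw [_root_.map_zero, sub_zero]
      refine (S.norm_conv_le hC hC0 hkm ht).trans_lt (lt_of_le_of_lt ?_ hδε)
      exact mul_le_mul_of_nonneg_left h (by positivity)
  obtain ⟨y, hy, hpy⟩ := mem_iUnion₂.1 (hcov hp)
  refine mem_iUnion₂.2 ⟨y, hy, ?_⟩
  rw [Metric.mem_ball] at hpy ⊢
  calc dist (S.conv k t) y ≤ dist (S.conv k t) p + dist p y := dist_triangle _ _ _
    _ < ε / 2 + ε / 2 := add_lt_add (by rwa [dist_eq_norm]) hpy
    _ = ε := add_halves ε

end Compactness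

/-- Convolution as a map on continuous functions on `[0, T]`. -/
noncomputable def convC {T : ℝ} (hT : 0 ≤ T) (k : C(Icc (0 : ℝ) T, X)) : C(Icc (0 : ℝ) T, X) :=
  ⟨fun t => S.conv (IccExtend hT k) t, continuousOn_iff_continuous_domRestrict.1
    (S.continuousOn_conv (integrableOn_IccExtend hT k))⟩

theorem continuous_convC {T : ℝ} (hT : 0 ≤ T) : Continuous (S.convC hT) := by
  obtain ⟨C, hC0, hC⟩ := S.exists_norm_le T
  refine (LipschitzWith.of_dist_le_mul (K := (C * T).toNNReal) fun k l => ?_).continuous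
  rw [Real.coe_toNNReal _ (by positivity)]
  refine (ContinuousMap.dist_le (by positivity)).2 fun t => ?_
  have := S.norm_conv_le hC hC0 (k := fun s => IccExtend hT k s - IccExtend hT l s)
    (m := dist k l) (fun s _ => by
      rw [← dist_eq_norm]; exact ContinuousMap.dist_apply_le_dist _) t.2
  rw [S.conv_sub (integrableOn_IccExtend hT k) (integrableOn_IccExtend hT l) t.2] at this
  rw [dist_eq_norm]
  refine this.trans ?_
  have h1 : (0 : ℝ) ≤ dist k l := dist_nonneg
  have h2 := t.2.2
  calc C * dist k l * t ≤ C * dist k l * T := mul_le_mul_of_nonneg_left h2 (by positivity)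
    _ = C * T * dist k l := by ring

/-- Convolution with a compact semigroup is a compact map on `C([0, T], X)`. -/
theorem exists_isCompact_convC_mem (hS : S.IsCompact) {T : ℝ} (hT : 0 ≤ T) {m : ℝ} (hm : 0 ≤ m) :
    ∃ Q : Set C(Icc (0 : ℝ) T, X), _root_.IsCompact Q ∧ ∀ k, ‖k‖ ≤ m → S.convC hT k ∈ Q := by
  obtain ⟨C, hC0, hC⟩ := S.exists_norm_le T
  set Z := {x : X | ∃ k : ℝ → X, IntegrableOn k (Icc 0 T) ∧ (∀ s ∈ Ioc 0 T, ‖k s‖ ≤ m) ∧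
      ∃ t ∈ Icc 0 T, S.conv k t = x}
  have hZ : _root_.IsCompact (closure Z) :=
    (totallyBounded_conv hS T m hm).closure.isCompact_of_isClosed isClosed_closure
  have hbd : ∀ k : C(Icc (0 : ℝ) T, X), ‖k‖ ≤ m → ∀ s ∈ Ioc 0 T, ‖IccExtend hT k s‖ ≤ m :=
    fun k hk s _ => (k.norm_coe_le_norm _).trans hk
  have hmem : ∀ k : C(Icc (0 : ℝ) T, X), ‖k‖ ≤ m → ∀ t : Icc (0 : ℝ) T,
      S.conv (IccExtend hT k) t ∈ closure Z := fun k hk t =>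
    subset_closure ⟨_, integrableOn_IccExtend hT k, hbd k hk, t, t.2, rfl⟩
  let e := ContinuousMap.isometryEquivBoundedOfCompact (Icc (0 : ℝ) T) X
  let A : Set (BoundedContinuousFunction (Icc (0 : ℝ) T) X) :=
    {y | ∃ k : C(Icc (0 : ℝ) T, X), ‖k‖ ≤ m ∧ e (S.convC hT k) = y}
  -- The increment is `(S (t - s) - 1)` applied to a point of the compact `closure Z`, plus a short
  -- integral; strong continuity is uniform on `closure Z`.
  have hinc : ∀ ε > 0, ∃ δ > 0, ∀ k : C(Icc (0 : ℝ) T, X), ‖k‖ ≤ m → ∀ s t : Icc (0 : ℝ) T,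
      s ≤ t → dist t s < δ → dist (S.convC hT k s) (S.convC hT k t) < ε := by
    intro ε hε
    obtain ⟨δ, hδ, hunif⟩ := S.exists_forall_norm_sub_lt hZ (half_pos hε)
    refine ⟨min δ (ε / 2 / (C * m + 1)), lt_min hδ (by positivity), fun k hk s t hst hd => ?_⟩
    have hst' : (s : ℝ) ≤ t := hst
    have hd' : (t : ℝ) - s < min δ (ε / 2 / (C * m + 1)) := by
      have : dist t s = |(t : ℝ) - s| := rfl
      rwa [this, abs_of_nonneg (sub_nonneg.2 hst')] at hd
    have h1 := S.conv_add_time (integrableOn_IccExtend hT k) s.2.1 (sub_nonneg.2 hst')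
      (by linarith [t.2.2])
    rw [add_sub_cancel] at h1
    have h2 := S.norm_integral_apply_le hC hC0 (hbd k hk) s.2.1 hst' t.2.2
    have h3 := hunif _ (sub_nonneg.2 hst') (hd'.trans_le (min_le_left _ _)) _ (hmem k hk s)
    have h4 : C * m * ((t : ℝ) - s) < ε / 2 := by
      have := hd'.trans_le (min_le_right _ _)
      rw [lt_div_iff₀ (by positivity)] at this
      linarith [sub_nonneg.2 hst']
    rw [dist_comm, dist_eq_norm]
    change ‖S.conv _ t - S.conv _ s‖ < ε
    rw [h1, add_sub_right_comm]
    exact (norm_add_le _ _).trans_lt (by linarith)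
  have hA : _root_.IsCompact (closure A) := by
    refine BoundedContinuousFunction.arzela_ascoli (closure Z) hZ A ?_ ?_
    · rintro _ t ⟨k, hk, rfl⟩
      exact hmem k hk t
    · intro t
      rw [Metric.equicontinuousAt_iff]
      intro ε hε
      obtain ⟨δ, hδ, h⟩ := hinc ε hε
      refine ⟨δ, hδ, ?_⟩
      rintro s hs ⟨_, k, hk, rfl⟩
      rcases le_total s t with hst | hst
      · rw [dist_comm]
        exact h k hk s t hst (by rwa [dist_comm])
      · exact h k hk t s hst hs
  refine ⟨e.symm '' closure A, hA.image e.symm.continuous, fun k hk => ?_⟩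
  exact ⟨e (S.convC hT k), subset_closure ⟨k, hk, rfl⟩, e.symm_apply_apply _⟩

end C0Semigroup

/-! ### Rescaling, and density of the responses to constant controls. -/

namespace C0Semigroup

variable {𝕜 X : Type*} [RCLike 𝕜] [NormedAddCommGroup X] [InnerProductSpace 𝕜 X]

/-- The rescaled semigroup `t ↦ exp (-c t) S t`. -/
noncomputable def scale (S : C0Semigroup 𝕜 X) (c : ℝ) : C0Semigroup 𝕜 X where
  toFun t := ((Real.exp (-c * t) : ℝ) : 𝕜) • S t
  map_zero := by simp [S.map_zero]
  map_add s t hs ht := by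
    ext x
    simp only [S.map_add s t hs ht, mul_add, Real.exp_add, RCLike.ofReal_mul,
      smul_apply, ContinuousLinearMap.comp_apply, map_smul, smul_smul]
    rw [mul_comm]
  strong_continuity x := by
    have : Continuous fun t : ℝ => ((Real.exp (-c * t) : ℝ) : 𝕜) :=
      RCLike.continuous_ofReal.comp (by fun_prop)
    exact this.continuousOn.smul (S.strong_continuity x)

theorem exists_norm_scale_le_half (S : C0Semigroup 𝕜 X) {T : ℝ} (hT : 0 < T) :
    ∃ c : ℝ, ‖S.scale c T‖ ≤ 1 / 2 := by
  have h1 : Tendsto (fun c : ℝ => Real.exp (-c * T) * ‖S T‖) atTop (𝓝 0) := by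
    have : Tendsto (fun c : ℝ => -c * T) atTop atBot := by
      simp_rw [neg_mul]
      exact tendsto_neg_atTop_atBot.comp (tendsto_id.atTop_mul_const hT)
    simpa using (Real.tendsto_exp_atBot.comp this).mul_const ‖S T‖
  obtain ⟨c, hc⟩ := (h1.eventually (gt_mem_nhds (show (0 : ℝ) < 1 / 2 by norm_num))).exists
  refine ⟨c, ?_⟩
  have : ‖S.scale c T‖ = Real.exp (-c * T) * ‖S T‖ := by
    change ‖((Real.exp (-c * T) : ℝ) : 𝕜) • S T‖ = _
    rw [norm_smul, RCLike.norm_ofReal, abs_of_pos (Real.exp_pos _)]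
  rw [this]
  exact hc.le

variable [NormedSpace ℝ X] (S : C0Semigroup 𝕜 X)

theorem conv_scale (c : ℝ) (k : ℝ → X) (t : ℝ) :
    (S.scale c).conv (fun s => ((Real.exp (-c * s) : ℝ) : 𝕜) • k s) t =
      ((Real.exp (-c * t) : ℝ) : 𝕜) • S.conv k t := by
  rw [conv, conv, ← intervalIntegral.integral_smul]
  refine intervalIntegral.integral_congr fun s _ => ?_
  change ((Real.exp (-c * (t - s)) : ℝ) : 𝕜) • S (t - s) (((Real.exp (-c * s) : ℝ) : 𝕜) • k s) =
    ((Real.exp (-c * t) : ℝ) : 𝕜) • S (t - s) (k s)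
  rw [map_smul, smul_smul, ← RCLike.ofReal_mul, ← Real.exp_add]
  congr 4
  ring

theorem conv_const_sub (w : X) (s t : ℝ) :
    S.conv (fun _ => w) (t - s) = ∫ r in s..t, S (r - s) w := by
  have := intervalIntegral.integral_comp_sub_left (a := 0) (b := t - s) (fun r => S (r - s) w) t
  rw [sub_sub_cancel, sub_zero] at this
  rw [← this, conv]
  refine intervalIntegral.integral_congr fun r _ => ?_
  simp only [sub_right_comm]

variable [CompleteSpace X]

theorem conv_const_add_time (w : X) {t h : ℝ} (ht : 0 ≤ t) (hh : 0 ≤ h) :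
    S.conv (fun _ => w) (t + h) = S h (S.conv (fun _ => w) t) + S.conv (fun _ => w) h := by
  rw [S.conv_add_time (T := t + h) (integrableOn_const (by simp)) ht hh le_rfl]
  congr 1
  have := intervalIntegral.integral_comp_sub_left (a := t) (b := t + h) (fun r => S r w) (t + h)
  rw [this, conv]
  have h2 := intervalIntegral.integral_comp_sub_left (a := 0) (b := h) (fun r => S r w) h
  rw [h2]
  congr 1 <;> ring

/-- The operator `w ↦ ∫₀ᵀ S (T - s) w ds`. -/
noncomputable def convConstCLM {T : ℝ} (hT : 0 ≤ T) : X →L[𝕜] X :=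
  LinearMap.mkContinuousOfExistsBound
    { toFun := fun w => S.conv (fun _ => w) T
      map_add' := fun v w => S.conv_add (integrableOn_const (by simp)) (integrableOn_const (by simp))
        ⟨hT, le_rfl⟩
      map_smul' := fun c w => S.conv_smul c _ T }
    (by
      obtain ⟨C, hC0, hC⟩ := S.exists_norm_le T
      refine ⟨C * T, fun w => ?_⟩
      refine (S.norm_conv_le hC hC0 (k := fun _ => w) (m := ‖w‖) (fun _ _ => le_rfl)
        ⟨hT, le_rfl⟩).trans (le_of_eq (by ring)))

theorem convConstCLM_apply {T : ℝ} (hT : 0 ≤ T) (w : X) :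
    S.convConstCLM hT w = S.conv (fun _ => w) T := rfl

theorem conv_const_apply (w : X) {t h : ℝ} (ht : 0 ≤ t) (hh : 0 ≤ h) :
    S.conv (fun _ => S h w) t = S h (S.conv (fun _ => w) t) := by
  rw [conv, conv, ← ContinuousLinearMap.intervalIntegral_comp_comm _
    (S.intervalIntegrable_apply (integrableOn_const (by simp)) le_rfl ht le_rfl le_rfl)]
  refine intervalIntegral.integral_congr fun s hs => ?_
  rw [uIcc_of_le ht] at hs
  have hs' : 0 ≤ t - s := sub_nonneg.2 hs.2
  calc S (t - s) (S h w) = S (t - s + h) w := by rw [S.map_add _ _ hs' hh]; rfl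
    _ = S h (S (t - s) w) := by rw [add_comm, S.map_add _ _ hh hs']; rfl

/-- `(S T - 1) ∫₀ʰ S r w dr = (S h - 1) ∫₀ᵀ S r w dr`. -/
theorem apply_conv_const_sub_comm (w : X) {t h : ℝ} (ht : 0 ≤ t) (hh : 0 ≤ h) :
    S t (S.conv (fun _ => w) h) - S.conv (fun _ => w) h =
      S h (S.conv (fun _ => w) t) - S.conv (fun _ => w) t := by
  have h1 := S.conv_const_add_time w ht hh
  have h2 := S.conv_const_add_time w hh ht
  rw [add_comm h t, h1] at h2
  rw [sub_eq_sub_iff_add_eq_add]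
  exact h2.symm

/-- Since `‖S T‖ ≤ 1 / 2`, the operator `S T - 1` is bounded below by `1 / 2`, and it sends the
response at time `h` to `S h - 1` applied to the response at time `T`. Terminal smallness thus
controls all earlier times. -/
theorem norm_conv_const_le {T C : ℝ} (hT : ‖S T‖ ≤ 1 / 2) (hC : ∀ t ∈ Icc (0 : ℝ) T, ‖S t‖ ≤ C)
    (w : X) {h : ℝ} (hh : h ∈ Icc 0 T) :
    ‖S.conv (fun _ => w) h‖ ≤ 2 * (C + 1) * ‖S.conv (fun _ => w) T‖ := by
  have h1 := S.apply_conv_const_sub_comm w (hh.1.trans hh.2) hh.1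
  have h2 := (S T).le_of_opNorm_le hT (S.conv (fun _ => w) h)
  have h3 := (S h).le_of_opNorm_le (hC h hh) (S.conv (fun _ => w) T)
  have h4 := norm_sub_le (S h (S.conv (fun _ => w) T)) (S.conv (fun _ => w) T)
  have h5 := norm_sub_norm_le (S.conv (fun _ => w) h) (S T (S.conv (fun _ => w) h))
  rw [norm_sub_rev, h1] at h5
  linarith

/-- Associativity of convolution with the constant kernel `1`. -/
theorem integral_conv_const {T : ℝ} {k : ℝ → X} (hk : IntegrableOn k (Icc 0 T)) (hT : 0 ≤ T) :
    IntervalIntegrable (fun s => S.conv (fun _ => k s) (T - s)) volume 0 T ∧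
      ∫ s in (0 : ℝ)..T, S.conv (fun _ => k s) (T - s) = ∫ r in (0 : ℝ)..T, S.conv k r := by
  obtain ⟨C, hC0, hC⟩ := S.exists_norm_le T
  -- The kernel lives on the triangle `s < r`; the two orders of integration give the two sides.
  let F : ℝ → ℝ → X := fun s r => if s < r then S (max (r - s) 0) (k s) else 0
  have hk' : IntegrableOn k (Ioc 0 T) := hk.mono_set Ioc_subset_Icc_self
  have hF : Integrable (Function.uncurry F)
      ((volume.restrict (Ioc 0 T)).prod (volume.restrict (Ioc 0 T))) := by
    refine Integrable.mono' ((hk'.norm.const_mul C).comp_fst (volume.restrict (Ioc 0 T))) ?_ ?_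
    · have h1 : AEStronglyMeasurable (fun p : ℝ × ℝ => S (max (p.2 - p.1) 0) (k p.1))
          ((volume.restrict (Ioc 0 T)).prod (volume.restrict (Ioc 0 T))) :=
        S.continuous_uncurry.comp_aestronglyMeasurable
          (((continuous_snd.sub continuous_fst).aestronglyMeasurable).prodMk hk'.1.comp_fst)
      have h2 := h1.indicator (measurableSet_lt measurable_fst measurable_snd)
      refine h2.congr (Eventually.of_forall fun p => ?_)
      simp [F, Function.uncurry, indicator_apply]
    · rw [Measure.prod_restrict]
      refine (ae_restrict_iff' (measurableSet_Ioc.prod measurableSet_Ioc)).2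
        (Eventually.of_forall fun p hp => ?_)
      obtain ⟨⟨h1, h2⟩, h3, h4⟩ := hp
      simp only [Function.uncurry, F]
      split_ifs with h
      · exact (S _).le_of_opNorm_le (hC _ ⟨le_max_right _ _, max_le (by linarith) hT⟩) _
      · rw [norm_zero]; positivity
  have hleft : EqOn (fun s => ∫ r in Ioc 0 T, F s r) (fun s => S.conv (fun _ => k s) (T - s))
      (Ioc 0 T) := by
    intro s hs
    have e : (fun r => F s r) = (Ioi s).indicator fun r => S (max (r - s) 0) (k s) := by
      ext r; simp [F, indicator_apply]
    have hset : Ioc 0 T ∩ Ioi s = Ioc s T := by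
      ext r
      simp only [mem_inter_iff, mem_Ioc, mem_Ioi]
      exact ⟨fun h => ⟨h.2, h.1.2⟩, fun h => ⟨⟨hs.1.trans h.1, h.2⟩, h.1⟩⟩
    simp only [e]
    rw [setIntegral_indicator measurableSet_Ioi, hset, conv_const_sub,
      intervalIntegral.integral_of_le hs.2]
    refine setIntegral_congr_fun measurableSet_Ioc fun r hr => ?_
    simp only [max_eq_left (sub_nonneg.2 hr.1.le)]
  refine ⟨(intervalIntegrable_iff_integrableOn_Ioc_of_le hT).2
    (IntegrableOn.congr_fun hF.integral_prod_left hleft measurableSet_Ioc), ?_⟩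
  rw [intervalIntegral.integral_of_le hT, intervalIntegral.integral_of_le hT]
  calc ∫ s in Ioc 0 T, S.conv (fun _ => k s) (T - s)
      = ∫ s in Ioc 0 T, ∫ r in Ioc 0 T, F s r :=
        (setIntegral_congr_fun measurableSet_Ioc hleft).symm
    _ = ∫ r in Ioc 0 T, ∫ s in Ioc 0 T, F s r := integral_integral_swap hF
    _ = ∫ r in Ioc 0 T, S.conv k r := by
        refine setIntegral_congr_fun measurableSet_Ioc fun r hr => ?_
        have e : (fun s => F s r) = (Iio r).indicator fun s => S (max (r - s) 0) (k s) := by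
          ext s; simp [F, indicator_apply]
        have hset : Ioc 0 T ∩ Iio r = Ioo 0 r := by
          ext s
          simp only [mem_inter_iff, mem_Ioc, mem_Iio, mem_Ioo]
          exact ⟨fun h => ⟨h.1.1, h.2⟩, fun h => ⟨⟨h.1, h.2.le.trans hr.2⟩, h.2⟩⟩
        simp only [e]
        rw [setIntegral_indicator measurableSet_Iio, hset, conv,
          intervalIntegral.integral_of_le hr.1.le, integral_Ioc_eq_integral_Ioo]
        refine setIntegral_congr_fun measurableSet_Ioo fun s hs => ?_
        simp only [max_eq_left (sub_nonneg.2 hs.2.le)]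

/-- Weak form of the variation of constants formula, tested against a functional `P` in the domain
of the adjoint generator, with `a` its image. -/
theorem apply_conv_eq_integral {T : ℝ} (hT : 0 ≤ T) {k : ℝ → X} (hk : IntegrableOn k (Icc 0 T))
    {P a : X →L[𝕜] 𝕜} (hP : ∀ x, ∀ t ∈ Icc 0 T, P (S t x) = P x + a (S.conv (fun _ => x) t)) :
    P (S.conv k T) = ∫ s in (0 : ℝ)..T, (P (k s) + a (S.conv k s)) := by
  have hS := S.intervalIntegrable_apply hk le_rfl hT le_rfl le_rfl
  have hk' : IntervalIntegrable k volume 0 T :=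
    (intervalIntegrable_iff_integrableOn_Ioc_of_le hT).2 (hk.mono_set Ioc_subset_Icc_self)
  have hPk : IntervalIntegrable (fun s => P (k s)) volume 0 T :=
    ⟨P.integrable_comp hk'.1, P.integrable_comp hk'.2⟩
  have hconv : IntervalIntegrable (S.conv k) volume 0 T :=
    (S.continuousOn_conv hk).intervalIntegrable_of_Icc hT
  have hac : IntervalIntegrable (fun s => a (S.conv k s)) volume 0 T :=
    ⟨a.integrable_comp hconv.1, a.integrable_comp hconv.2⟩
  obtain ⟨hJ, hJeq⟩ := S.integral_conv_const hk hT
  have haJ : IntervalIntegrable (fun s => a (S.conv (fun _ => k s) (T - s))) volume 0 T :=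
    ⟨a.integrable_comp hJ.1, a.integrable_comp hJ.2⟩
  rw [intervalIntegral.integral_add hPk hac, a.intervalIntegral_comp_comm hconv, ← hJeq,
    ← a.intervalIntegral_comp_comm hJ, ← intervalIntegral.integral_add hPk haJ, conv,
    ← P.intervalIntegral_comp_comm hS]
  refine intervalIntegral.integral_congr fun s hs => ?_
  rw [uIcc_of_le hT] at hs
  exact hP _ _ ⟨sub_nonneg.2 hs.2, by linarith [hs.1]⟩

/-- If all bounded perturbations are approximately controllable, then the range of
`u ↦ ∫₀ᵀ S~ (T - s) B u ds`, with `S~` the rescaled semigroup, is dense in the range of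
`x ↦ ∫₀ᵀ S~ (T - s) x ds`. Otherwise a functional `P ≠ 0` in the domain of the adjoint generator
kills `B`, and a rank one perturbation makes `P` constant along all trajectories. -/
theorem exists_norm_conv_const_sub_lt {U : Type*} [NormedAddCommGroup U] [InnerProductSpace 𝕜 U]
    (B : U →L[𝕜] X) {T : ℝ} (hT : 0 < T)
    (hAC : ∀ G : ℝ → X →L[𝕜] X, MemLp G 2 (volume.restrict (Icc 0 T)) →
      ApproximatelyControllable S B (fun t y => G t y) T)
    (c : ℝ) (x : X) {ε : ℝ} (hε : 0 < ε) :
    ∃ u : U, ‖(S.scale c).conv (fun _ => B u - x) T‖ < ε := by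
  set S' := S.scale c with hS'
  set J : X →L[𝕜] X := S'.convConstCLM hT.le with hJ
  let W : Submodule 𝕜 X := LinearMap.range ((J.comp B : U →L[𝕜] X) : U →ₗ[𝕜] X)
  suffices hmem : J x ∈ W.topologicalClosure by
    obtain ⟨_, ⟨u, rfl⟩, hu⟩ := Metric.mem_closure_iff.1
      (show J x ∈ closure (W : Set X) from hmem) ε hε
    refine ⟨u, ?_⟩
    rw [← S'.convConstCLM_apply hT.le, ← hJ, _root_.map_sub, norm_sub_rev, ← dist_eq_norm]
    exact hu
  by_contra hcon
  rw [← Submodule.orthogonal_orthogonal_eq_closure, Submodule.mem_orthogonal] at hcon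
  push Not at hcon
  obtain ⟨q, hq, hqx⟩ := hcon
  let ℓ : X →L[𝕜] 𝕜 := innerSL 𝕜 q
  -- Formally `J` is the resolvent-like integral with `A' J = S' T - 1`, for `A'` the rescaled
  -- generator, so `a` plays the role of `P A'` while staying bounded.
  let P : X →L[𝕜] 𝕜 := ℓ.comp J
  let a : X →L[𝕜] 𝕜 := ℓ.comp (S' T) - ℓ
  have hPB : ∀ u, P (B u) = 0 := fun u =>
    inner_eq_zero_symm.1 ((Submodule.mem_orthogonal W q).1 hq _ ⟨u, rfl⟩)
  have hPx : P x ≠ 0 := hqx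
  have hP : ∀ z, ∀ t ∈ Icc 0 T, P (S' t z) = P z + a (S'.conv (fun _ => z) t) := by
    intro z t ht
    have h1 : J (S' t z) = S' t (J z) := S'.conv_const_apply z hT.le ht.1
    have h2 := S'.apply_conv_const_sub_comm z hT.le ht.1
    have h3 : a (S'.conv (fun _ => z) t) = ℓ (S' t (J z)) - ℓ (J z) := by
      simp only [a, sub_apply, ContinuousLinearMap.comp_apply]
      rw [← _root_.map_sub, h2, _root_.map_sub]
      rfl
    simp only [P, ContinuousLinearMap.comp_apply]
    rw [h3, h1, add_sub_cancel]
  let v : X := (P x)⁻¹ • x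
  have hPv : P v = 1 := by simp [v, hPx]
  -- As `P v = 1`, the feedback `-a(y) v` exactly cancels the drift `a(y)` of `P`. Hence `P (y T) =
  -- 0`, whereas the tolerance `1 / (‖P‖ + 1)` puts `P (y T)` within less than `1` of `P v = 1`.
  obtain ⟨u, y, hu, ⟨hyc, hy⟩, -, hyT⟩ := hAC (fun _ => -(a.smulRight v)) (memLp_const _) 0 v
    (1 / (‖P‖ + 1)) (by positivity)
  let k : ℝ → X := fun s => B (u s) + (-(a.smulRight v)) (y s)
  have hk : IntegrableOn k (Icc 0 T) := by
    refine Integrable.add (B.integrable_comp (hu.integrable one_le_two)) ?_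
    exact ContinuousLinearMap.integrable_comp _ (hyc.integrableOn_compact isCompact_Icc)
  have hyk : ∀ t ∈ Icc 0 T, y t = S.conv k t := fun t ht => by
    rw [hy t ht, _root_.map_zero, zero_add]; rfl
  let ex : ℝ → 𝕜 := fun s => ((Real.exp (-c * s) : ℝ) : 𝕜)
  have hex : Continuous ex := RCLike.continuous_ofReal.comp (by fun_prop)
  have hk' : IntegrableOn (fun s => ex s • k s) (Icc 0 T) :=
    hk.continuousOn_smul hex.continuousOn isCompact_Icc
  have hconv : ∀ t ∈ Icc 0 T, S'.conv (fun s => ex s • k s) t = ex t • y t := fun t ht => by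
    rw [hyk t ht]; exact S.conv_scale c k t
  have hzero : P (S'.conv (fun s => ex s • k s) T) = 0 := by
    rw [S'.apply_conv_eq_integral hT.le hk' hP]
    refine (intervalIntegral.integral_congr fun s hs => ?_).trans intervalIntegral.integral_zero
    rw [uIcc_of_le hT.le] at hs
    have : P (k s) = -a (y s) := by
      simp only [k, _root_.map_add, hPB, zero_add]
      simp [hPv]
    simp only [hconv s hs, map_smul, this]
    rw [← smul_add, neg_add_cancel, smul_zero]
  rw [hconv T ⟨hT.le, le_rfl⟩, map_smul, smul_eq_zero] at hzero
  have hPy : P (y T) = 0 := hzero.resolve_left (by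
    simp only [ex, RCLike.ofReal_eq_zero]; exact (Real.exp_pos _).ne')
  have h1 := P.le_opNorm (y T - v)
  rw [_root_.map_sub, hPy, hPv, zero_sub, norm_neg, norm_one] at h1
  rw [lt_div_iff₀ (by positivity)] at hyT
  linarith [norm_nonneg (y T - v)]

end C0Semigroup

/-! ### Uniform tracking of continuous forcing by controls. -/

namespace C0Semigroup

variable {𝕜 X U : Type*} [RCLike 𝕜] [NormedAddCommGroup X] [InnerProductSpace 𝕜 X]
  [NormedAddCommGroup U] [InnerProductSpace 𝕜 U]

theorem integrableOn_control {B : U →L[𝕜] X} {T : ℝ} {u : ℝ → U}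
    (hu : MemLp u 2 (volume.restrict (Icc 0 T))) :
    IntegrableOn (fun s => B (u s)) (Icc 0 T) :=
  B.integrable_comp (hu.integrable one_le_two)

variable [NormedSpace ℝ X]

/-- The response to `h` on `[0, T]` can be uniformly approximated by responses to controls. -/
def IsTrackable (S : C0Semigroup 𝕜 X) (B : U →L[𝕜] X) (T : ℝ) (h : ℝ → X) : Prop :=
  ∀ ε > 0, ∃ u : ℝ → U, MemLp u 2 (volume.restrict (Icc 0 T)) ∧
    ∀ t ∈ Icc 0 T, ‖S.conv (fun s => B (u s)) t - S.conv h t‖ ≤ ε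

variable {S : C0Semigroup 𝕜 X} {B : U →L[𝕜] X} {T : ℝ}

theorem conv_indicator_Ioi (S : C0Semigroup 𝕜 X) (w : X) {a t : ℝ} (ha : 0 ≤ a) (ht : 0 ≤ t) :
    S.conv ((Ioi a).indicator fun _ => w) t = S.conv (fun _ => w) (max (t - a) 0) := by
  have e : (fun s => S (t - s) ((Ioi a).indicator (fun _ => w) s)) =
      (Ioi a).indicator fun s => S (t - s) w := by
    ext s
    by_cases hs : s ∈ Ioi a <;> simp [hs]
  have hset : Ioc 0 t ∩ Ioi a = Ioc a t := by
    ext s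
    simp only [mem_inter_iff, mem_Ioc, mem_Ioi]
    exact ⟨fun h => ⟨h.2, h.1.2⟩, fun h => ⟨⟨ha.trans_lt h.1, h.2⟩, h.1⟩⟩
  rw [conv, e, intervalIntegral.integral_of_le ht, setIntegral_indicator measurableSet_Ioi, hset]
  rcases le_total a t with h | h
  · rw [max_eq_left (sub_nonneg.2 h), ← intervalIntegral.integral_of_le h, conv]
    rw [intervalIntegral.integral_comp_sub_left (fun r => S r w) t,
      intervalIntegral.integral_comp_sub_left (fun r => S r w) (t - a)]
    simp
  · rw [max_eq_right (sub_nonpos.2 h), conv_zero, Ioc_eq_empty (not_lt.2 h)]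
    simp

variable [CompleteSpace X]

theorem IsTrackable.add {h k : ℝ → X} (hh : IsTrackable S B T h) (hk : IsTrackable S B T k)
    (hhi : IntegrableOn h (Icc 0 T)) (hki : IntegrableOn k (Icc 0 T)) :
    IsTrackable S B T fun s => h s + k s := by
  intro ε hε
  obtain ⟨u, hu, hu'⟩ := hh (ε / 2) (by positivity)
  obtain ⟨v, hv, hv'⟩ := hk (ε / 2) (by positivity)
  refine ⟨fun s => u s + v s, hu.add hv, fun t ht => ?_⟩
  simp only [_root_.map_add]
  rw [S.conv_add (integrableOn_control hu) (integrableOn_control hv) ht, S.conv_add hhi hki ht,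
    add_sub_add_comm]
  exact (norm_add_le _ _).trans (by linarith [hu' t ht, hv' t ht])

theorem IsTrackable.sum {ι : Type*} (I : Finset ι) {h : ι → ℝ → X}
    (hh : ∀ i ∈ I, IsTrackable S B T (h i)) (hi : ∀ i ∈ I, IntegrableOn (h i) (Icc 0 T)) :
    IsTrackable S B T fun s => ∑ i ∈ I, h i s := by
  classical
  induction I using Finset.induction_on with
  | empty =>
    intro ε hε
    exact ⟨0, MemLp.zero', fun t _ => by simp [conv, hε.le]⟩
  | insert i I hiI ih =>
    simp_rw [Finset.sum_insert hiI]
    refine IsTrackable.add (hh i (Finset.mem_insert_self i I))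
      (ih (fun j hj => hh j (Finset.mem_insert_of_mem hj))
        fun j hj => hi j (Finset.mem_insert_of_mem hj)) (hi i (Finset.mem_insert_self i I))
      (integrable_finsetSum _ fun j hj => hi j (Finset.mem_insert_of_mem hj))

/-- Forcing switched on at time `a` produces a delayed response, so the error at `t` is the
constant-forcing error at `max (t - a) 0`. This is why `hB` is needed at all times and not only at
`T`. -/
theorem isTrackable_indicator_Ioi
    (hB : ∀ x : X, ∀ ε > 0, ∃ u : U, ∀ t ∈ Icc 0 T, ‖S.conv (fun _ => B u - x) t‖ ≤ ε)
    {a : ℝ} (ha : 0 ≤ a) (x : X) : IsTrackable S B T ((Ioi a).indicator fun _ => x) := by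
  intro ε hε
  obtain ⟨u, hu⟩ := hB x ε hε
  refine ⟨(Ioi a).indicator fun _ => u, (memLp_const u).indicator measurableSet_Ioi,
    fun t ht => ?_⟩
  have hmem : max (t - a) 0 ∈ Icc 0 T :=
    ⟨le_max_right _ _, max_le (by linarith [ht.2]) (ht.1.trans ht.2)⟩
  have e : (fun s => B ((Ioi a).indicator (fun _ => u) s)) = (Ioi a).indicator fun _ => B u := by
    ext s
    by_cases hs : s ∈ Ioi a <;> simp [hs]
  rw [e, S.conv_indicator_Ioi _ ha ht.1, S.conv_indicator_Ioi _ ha ht.1,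
    ← S.conv_sub (T := T) (integrableOn_const (by simp)) (integrableOn_const (by simp)) hmem]
  exact hu _ hmem

/-- Continuous functions are uniform limits of left-continuous step functions. -/
theorem exists_step_approx {E : Type*} [NormedAddCommGroup E] {h : ℝ → E} (hT : 0 < T)
    (hh : ContinuousOn h (Icc 0 T)) {ε : ℝ} (hε : 0 < ε) :
    ∃ (n : ℕ) (a : ℕ → ℝ) (d : ℕ → E), (∀ i, 0 ≤ a i) ∧ ∀ s ∈ Ioc 0 T,
      ‖(∑ i ∈ Finset.range n, (Ioi (a i)).indicator (fun _ => d i) s) - h s‖ ≤ ε := by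
  obtain ⟨δ, hδ, huc⟩ := Metric.uniformContinuousOn_iff.1
    (isCompact_Icc.uniformContinuousOn_of_continuous hh) ε hε
  obtain ⟨n, hn⟩ := exists_nat_gt (T / δ)
  have hn0 : (0 : ℝ) < n := (div_pos hT hδ).trans hn
  let τ : ℝ := T / n
  have hτ : 0 < τ := div_pos hT hn0
  have hτδ : τ < δ := by
    rw [div_lt_iff₀ hδ] at hn
    rw [div_lt_iff₀ hn0]; linarith
  -- The index is shifted by one so that the jumps telescope from `0`: on `(i τ, (i + 1) τ]` the
  -- step function equals `h (i τ)`.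
  let c : ℕ → E := fun i => if i = 0 then 0 else h (((i : ℝ) - 1) * τ)
  refine ⟨n, fun i => i * τ, fun i => c (i + 1) - c i, fun i => by positivity, fun s hs => ?_⟩
  have hcn : ⌈s / τ⌉₊ ≤ n := by
    refine Nat.ceil_le.2 ?_
    rw [div_le_iff₀ hτ, mul_div_cancel₀ _ hn0.ne']
    exact hs.2
  have hc0 : 0 < ⌈s / τ⌉₊ := Nat.ceil_pos.2 (div_pos hs.1 hτ)
  have hsum : ∑ i ∈ Finset.range n, (Ioi ((i : ℝ) * τ)).indicator (fun _ => c (i + 1) - c i) s =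
      c ⌈s / τ⌉₊ := by
    have hfil : (Finset.range n).filter (fun i : ℕ => (i : ℝ) * τ < s) =
        Finset.range ⌈s / τ⌉₊ := by
      ext i
      simp only [Finset.mem_filter, Finset.mem_range]
      rw [← lt_div_iff₀ hτ, ← Nat.lt_ceil]
      exact ⟨fun h => h.2, fun h => ⟨h.trans_le hcn, h⟩⟩
    simp only [indicator_apply, mem_Ioi]
    rw [← Finset.sum_filter, hfil, Finset.sum_range_sub]
    simp [c]
  rw [hsum]
  have hlt := Nat.ceil_lt_add_one (div_pos hs.1 hτ).le
  have hge := Nat.le_ceil (s / τ)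
  rw [div_le_iff₀ hτ] at hge
  have hlt' : ((⌈s / τ⌉₊ : ℝ) - 1) * τ < s := by
    rw [← lt_div_iff₀ hτ]; linarith
  have h1 : (1 : ℝ) ≤ ⌈s / τ⌉₊ := by exact_mod_cast hc0
  have hp0 : 0 ≤ ((⌈s / τ⌉₊ : ℝ) - 1) * τ := mul_nonneg (by linarith) hτ.le
  simp only [c, hc0.ne', if_false]
  rw [← dist_eq_norm]
  refine (huc _ ⟨hp0, hlt'.le.trans hs.2⟩ _ (Ioc_subset_Icc_self hs) ?_).le
  rw [Real.dist_eq, abs_sub_comm, abs_of_nonneg (sub_nonneg.2 hlt'.le)]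
  nlinarith

/-- Convolution is bounded by the supremum of the forcing, so a uniform step approximation costs at
most half of `ε`; each step is trackable. -/
theorem isTrackable_of_continuousOn (hT : 0 < T)
    (hB : ∀ x : X, ∀ ε > 0, ∃ u : U, ∀ t ∈ Icc 0 T, ‖S.conv (fun _ => B u - x) t‖ ≤ ε)
    {h : ℝ → X} (hh : ContinuousOn h (Icc 0 T)) : IsTrackable S B T h := by
  intro ε hε
  obtain ⟨C, hC0, hC⟩ := S.exists_norm_le T
  obtain ⟨n, a, d, ha, had⟩ := exists_step_approx hT hh
    (show 0 < ε / 2 / (C * T + 1) by positivity)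
  have hint : ∀ i ∈ Finset.range n,
      IntegrableOn ((Ioi (a i)).indicator fun _ => d i) (Icc 0 T) := fun i _ =>
    (integrableOn_const (by simp)).integrable.indicator measurableSet_Ioi
  obtain ⟨u, hu, hu'⟩ := IsTrackable.sum (S := S) (B := B) (Finset.range n)
    (fun i _ => isTrackable_indicator_Ioi hB (ha i) (d i)) hint (ε / 2) (by positivity)
  refine ⟨u, hu, fun t ht => ?_⟩
  have h1 := S.norm_conv_le hC hC0 had ht
  rw [S.conv_sub (integrable_finsetSum _ hint) (hh.integrableOn_compact isCompact_Icc) ht] at h1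
  have h2 : C * (ε / 2 / (C * T + 1)) * t ≤ ε / 2 := by
    calc C * (ε / 2 / (C * T + 1)) * t ≤ C * (ε / 2 / (C * T + 1)) * T :=
          mul_le_mul_of_nonneg_left ht.2 (by positivity)
      _ = ε / 2 * (C * T / (C * T + 1)) := by ring
      _ ≤ ε / 2 * 1 := mul_le_mul_of_nonneg_left
          ((div_le_one (by positivity)).2 (by linarith)) (by positivity)
      _ = ε / 2 := mul_one _
  exact (norm_sub_le_norm_sub_add_norm_sub _ _ _).trans
    ((add_le_add (hu' t ht) (h1.trans h2)).trans (le_of_eq (add_halves ε)))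

/-- If all bounded perturbations are approximately controllable, then the response to any continuous
function is uniformly approximated by responses to controls. -/
theorem isTrackable_of_approximatelyControllable (hT : 0 < T)
    (hAC : ∀ G : ℝ → X →L[𝕜] X, MemLp G 2 (volume.restrict (Icc 0 T)) →
      ApproximatelyControllable S B (fun t y => G t y) T)
    {h : ℝ → X} (hh : ContinuousOn h (Icc 0 T)) : IsTrackable S B T h := by
  obtain ⟨c, hc⟩ := S.exists_norm_scale_le_half hT
  obtain ⟨C, hC0, hC⟩ := (S.scale c).exists_norm_le T
  have hB : ∀ x : X, ∀ ε > 0, ∃ u : U, ∀ t ∈ Icc 0 T,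
      ‖(S.scale c).conv (fun _ => B u - x) t‖ ≤ ε := by
    intro x ε hε
    obtain ⟨u, hu⟩ := S.exists_norm_conv_const_sub_lt B hT hAC c x
      (show 0 < ε / (2 * (C + 1)) by positivity)
    refine ⟨u, fun t ht => ((S.scale c).norm_conv_const_le hc hC _ ht).trans ?_⟩
    rw [lt_div_iff₀ (by positivity)] at hu
    linarith
  let ex : ℝ → ℝ → 𝕜 := fun b s => ((Real.exp (b * s) : ℝ) : 𝕜)
  have hex : ∀ b, Continuous (ex b) := fun b => RCLike.continuous_ofReal.comp (by fun_prop)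
  have hmul : ∀ s, ex (-c) s * ex c s = 1 := fun s => by
    simp only [ex]
    rw [← RCLike.ofReal_mul, ← Real.exp_add]
    simp
  obtain ⟨D, hD⟩ := (isCompact_Icc (a := (0 : ℝ)) (b := T)).exists_bound_of_continuousOn
    (hex c).continuousOn
  have hD0 : 0 ≤ D := (norm_nonneg _).trans (hD 0 ⟨le_rfl, hT.le⟩)
  intro ε hε
  -- Track `exp (-c s) h(s)` for the rescaled semigroup, then undo the weight with the control `exp
  -- (c s) u(s)`; `D` bounds the factor lost.
  obtain ⟨u, hu, hu'⟩ := isTrackable_of_continuousOn (S := S.scale c) hT hB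
    ((hex (-c)).continuousOn.smul hh) (ε / (D + 1)) (by positivity)
  refine ⟨fun s => ex c s • u s, ?_, fun t ht => ?_⟩
  · have hm : MemLp (ex c) ⊤ (volume.restrict (Icc 0 T)) :=
      memLp_top_of_bound (hex c).aestronglyMeasurable D
        ((ae_restrict_iff' measurableSet_Icc).2 (Eventually.of_forall hD))
    exact hu.smul hm
  · have h1 := S.conv_scale c (fun s => B (ex c s • u s)) t
    have h2 := S.conv_scale c h t
    have h3 : (fun s => ((Real.exp (-c * s) : ℝ) : 𝕜) • B (ex c s • u s)) = fun s => B (u s) := by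
      ext s
      rw [map_smul, smul_smul]
      exact (congrArg (· • B (u s)) (hmul s)).trans (one_smul _ _)
    rw [h3] at h1
    have h4 := hu' t ht
    rw [h1] at h4
    have h5 : (S.scale c).conv (ex (-c) • h) t = ex (-c) t • S.conv h t := h2
    rw [h5] at h4
    change ‖ex (-c) t • _ - ex (-c) t • _‖ ≤ _ at h4
    rw [← smul_sub] at h4
    set w := S.conv (fun s => B (ex c s • u s)) t - S.conv h t
    have h6 : w = ex c t • (ex (-c) t • w) := by
      rw [smul_smul, mul_comm, hmul, one_smul]
    rw [h6, norm_smul]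
    calc ‖ex c t‖ * ‖ex (-c) t • w‖ ≤ D * (ε / (D + 1)) :=
          mul_le_mul (hD t ht) h4 (norm_nonneg _) hD0
      _ ≤ ε := by
          rw [mul_div_assoc', div_le_iff₀ (by positivity)]
          nlinarith

end C0Semigroup

/-! ### Closed-loop control for bounded nonlinear terms. -/

/-- The square-integrable controls on `[0, T]`. -/
def controlSpace (𝕜 U : Type*) [RCLike 𝕜] [NormedAddCommGroup U] [InnerProductSpace 𝕜 U] (T : ℝ) :
    Submodule 𝕜 (ℝ → U) where
  carrier := {u | MemLp u 2 (volume.restrict (Icc 0 T))}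
  add_mem' hu hv := hu.add hv
  zero_mem' := MemLp.zero
  smul_mem' c _ hu := hu.const_smul c

section Clip

variable {X : Type*} [NormedAddCommGroup X] [NormedSpace ℝ X]

/-- The radial retraction onto the closed ball of radius `R`. -/
noncomputable def radialClip {R : ℝ} (hR : 0 < R) : C(X, X) :=
  ⟨fun x => (R / max R ‖x‖) • x, by
    have : ∀ x : X, max R ‖x‖ ≠ 0 := fun x => (lt_max_of_lt_left hR).ne'
    exact (continuous_const.div (continuous_const.max continuous_norm) this).smul continuous_id⟩

theorem norm_radialClip_le {R : ℝ} (hR : 0 < R) (x : X) : ‖radialClip hR x‖ ≤ R := by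
  have h : 0 < max R ‖x‖ := lt_max_of_lt_left hR
  change ‖(R / max R ‖x‖) • x‖ ≤ R
  rw [norm_smul, Real.norm_of_nonneg (by positivity), div_mul_eq_mul_div, div_le_iff₀ h]
  exact mul_le_mul_of_nonneg_left (le_max_right _ _) hR.le

theorem radialClip_of_norm_le {R : ℝ} (hR : 0 < R) {x : X} (hx : ‖x‖ ≤ R) :
    radialClip hR x = x := by
  change (R / max R ‖x‖) • x = x
  rw [max_eq_left hx, div_self hR.ne', one_smul]

end Clip

namespace C0Semigroup

variable {𝕜 X U : Type*} [RCLike 𝕜] [NormedAddCommGroup X] [InnerProductSpace 𝕜 X]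
  [NormedAddCommGroup U] [InnerProductSpace 𝕜 U]

/-- The free orbit `t ↦ S t y₀` on `[0, T]`. -/
noncomputable def orbit (S : C0Semigroup 𝕜 X) (T : ℝ) (y₀ : X) : C(Icc (0 : ℝ) T, X) :=
  ⟨fun t => S t y₀, continuousOn_iff_continuous_domRestrict.1
    ((S.strong_continuity y₀).mono Icc_subset_Ici_self)⟩

variable [NormedSpace ℝ X] [CompleteSpace X]

/-- The response `t ↦ ∫₀ᵗ S (t - s) B u(s) ds` as a linear function of the control. -/
noncomputable def response (S : C0Semigroup 𝕜 X) (B : U →L[𝕜] X) (T : ℝ) :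
    controlSpace 𝕜 U T →ₗ[𝕜] C(Icc (0 : ℝ) T, X) where
  toFun u := ⟨fun t => S.conv (fun s => B (u.1 s)) t, continuousOn_iff_continuous_domRestrict.1
    (S.continuousOn_conv (integrableOn_control u.2))⟩
  map_add' u v := by
    ext t
    change S.conv (fun s => B (u.1 s + v.1 s)) t = _
    simp only [_root_.map_add]
    exact S.conv_add (integrableOn_control u.2) (integrableOn_control v.2) t.2
  map_smul' c u := by
    ext t
    change S.conv (fun s => B (c • u.1 s)) t = _
    simp only [map_smul]
    exact S.conv_smul c _ _

/-- Finite-approximate control of systems with a bounded continuous nonlinear term `N`, together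
with a bound, independent of `N`, on the distance to the reference trajectory driven by `u₀`. -/
theorem exists_control_of_bounded {S : C0Semigroup 𝕜 X} (hS : S.IsCompact) {B : U →L[𝕜] X} {T : ℝ}
    (hT : 0 < T)
    (htr : ∀ h : ℝ → X, ContinuousOn h (Icc 0 T) → IsTrackable S B T h)
    (M : Submodule 𝕜 X) [FiniteDimensional 𝕜 M] (Λ : M →ₗ[𝕜] controlSpace 𝕜 U T)
    (hΛ : ∀ c : M, M.orthogonalProjectionOnto (S.response B T (Λ c) ⟨T, hT.le, le_rfl⟩) = c)
    {D : ℝ} (hD0 : 0 ≤ D) (hD : ∀ c, ‖S.response B T (Λ c)‖ ≤ D * ‖c‖)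
    {N : C(Icc (0 : ℝ) T, X) → C(Icc (0 : ℝ) T, X)} (hN : Continuous N) {m : ℝ}
    (hNm : ∀ y, ‖N y‖ ≤ m) (y₀ yf : X) (u₀ : controlSpace 𝕜 U T) {η : ℝ} (hη : 0 < η) :
    ∃ (u : controlSpace 𝕜 U T) (y : C(Icc (0 : ℝ) T, X)),
      y = S.orbit T y₀ + S.response B T u + S.convC hT.le (N y) ∧
      M.orthogonalProjectionOnto (y ⟨T, hT.le, le_rfl⟩) = M.orthogonalProjectionOnto yf ∧
      ‖y - (S.orbit T y₀ + S.response B T u₀)‖ ≤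
        D * (‖yf - (S.orbit T y₀ + S.response B T u₀) ⟨T, hT.le, le_rfl⟩‖ + η) + η := by
  have hm : 0 ≤ m := (norm_nonneg _).trans (hNm 0)
  set τ : Icc (0 : ℝ) T := ⟨T, hT.le, le_rfl⟩
  set W := S.response B T
  set V := S.convC hT.le
  set z := S.orbit T y₀ + W u₀
  obtain ⟨Q, hQ, hVQ⟩ := S.exists_isCompact_convC_mem hS hT.le hm
  have hVN : Continuous fun y => V (N y) := (S.continuous_convC hT.le).comp hN
  obtain ⟨t, w, ht, hwc, hw0, hw1, hwd⟩ := exists_finite_partition_of_totallyBounded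
    (K := range fun y => V (N y))
    (hQ.totallyBounded.subset (range_subset_iff.2 fun y => hVQ _ (hNm y))) hVN
    (fun y => mem_range_self y) (half_pos hη)
  have hex : ∀ i : t, ∃ v : controlSpace 𝕜 U T, ‖W v - i‖ ≤ η / 2 := by
    intro i
    obtain ⟨y, hy⟩ := ht i
    obtain ⟨v, hv, hv'⟩ := htr (IccExtend hT.le (N y)) (N y).continuous.Icc_extend'.continuousOn
      (η / 2) (half_pos hη)
    refine ⟨⟨v, hv⟩, ?_⟩
    rw [← hy]
    exact (ContinuousMap.norm_le _ (half_pos hη).le).2 fun s => hv' s s.2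
  choose v hv using hex
  -- Only finitely many controls are blended, so `W (R y)` is continuous in `y` although no topology
  -- is put on the control space.
  let R : C(Icc (0 : ℝ) T, X) → controlSpace 𝕜 U T := fun y => ∑ i, ((w i y : ℝ) : 𝕜) • v i
  have hWR : ∀ y, W (R y) = ∑ i, w i y • W (v i) := by
    intro y
    simp only [R, map_sum, map_smul]
    exact Finset.sum_congr rfl fun i _ => (RCLike.real_smul_eq_coe_smul (K := 𝕜) _ _).symm
  have hRV : ∀ y, ‖W (R y) - V (N y)‖ ≤ η := by
    intro y
    rw [hWR]
    refine norm_sum_smul_sub_le (fun i => hw0 i y) (hw1 y) fun i hi => ?_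
    have h1 := (hwd i y hi).le
    rw [dist_comm, dist_eq_norm] at h1
    exact (norm_sub_le_norm_sub_add_norm_sub _ _ _).trans
      ((add_le_add (hv i) h1).trans (le_of_eq (add_halves η)))
  -- This is the terminal miss of the control `u₀ - R y`; the `Λ` term in `u` below adds exactly its
  -- `M`-component.
  let res : C(Icc (0 : ℝ) T, X) → X := fun y => yf - z τ + (W (R y) - V (N y)) τ
  have hres : ∀ y, ‖M.orthogonalProjectionOnto (res y)‖ ≤ ‖yf - z τ‖ + η := by
    intro y
    refine (M.norm_orthogonalProjectionOnto_apply_le _).trans ((norm_add_le _ _).trans ?_)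
    exact add_le_add_right (((W (R y) - V (N y)).norm_coe_le_norm τ).trans (hRV y)) _
  let u : C(Icc (0 : ℝ) T, X) → controlSpace 𝕜 U T := fun y =>
    u₀ - R y + Λ (M.orthogonalProjectionOnto (res y))
  let Φ : C(Icc (0 : ℝ) T, X) → C(Icc (0 : ℝ) T, X) := fun y =>
    S.orbit T y₀ + W (u y) + V (N y)
  have hΦ : ∀ y, Φ y = z + W (Λ (M.orthogonalProjectionOnto (res y))) - (W (R y) - V (N y)) := by
    intro y
    simp only [Φ, u, z, _root_.map_add, _root_.map_sub]
    abel
  have hWRc : Continuous fun y => W (R y) := by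
    simp_rw [hWR]
    exact continuous_finsetSum _ fun i _ => (hwc i).smul continuous_const
  have hresc : Continuous res :=
    continuous_const.add ((continuous_eval_const τ).comp (hWRc.sub hVN))
  have hWΛ : Continuous fun c : M => W (Λ c) :=
    (W.comp Λ).continuous_of_finiteDimensional
  have hΦc : Continuous Φ := by
    simp_rw [funext hΦ]
    exact (continuous_const.add (hWΛ.comp (M.orthogonalProjectionOnto.continuous.comp hresc))).sub
      (hWRc.sub hVN)
  have : ProperSpace M := FiniteDimensional.proper_rclike 𝕜 M
  -- `Φ y` depends continuously on weights, a bounded vector of `M` and a point of `Q`, so its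
  -- values lie in a continuous image of a compact set.
  let P : Set ((t → ℝ) × M × C(Icc (0 : ℝ) T, X)) :=
    (univ.pi fun _ => Icc 0 1) ×ˢ Metric.closedBall 0 (‖yf - z τ‖ + η) ×ˢ Q
  have hP : _root_.IsCompact P :=
    (isCompact_univ_pi fun _ => isCompact_Icc).prod ((isCompact_closedBall _ _).prod hQ)
  have hΨ : Continuous fun p : (t → ℝ) × M × C(Icc (0 : ℝ) T, X) =>
      z + W (Λ p.2.1) - ((∑ i, p.1 i • W (v i)) - p.2.2) := by
    refine (continuous_const.add (hWΛ.comp (continuous_fst.comp continuous_snd))).sub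
      (Continuous.sub ?_ (continuous_snd.comp continuous_snd))
    exact continuous_finsetSum _ fun i _ => ((continuous_apply i).comp continuous_fst).smul
      continuous_const
  obtain ⟨y, hy⟩ := exists_fixedPoint_of_continuous_of_mem_compact (hP.image hΨ) hΦc fun y => by
    refine ⟨(fun i => w i y, M.orthogonalProjectionOnto (res y), V (N y)),
      ⟨fun i _ => ⟨hw0 i y, ?_⟩, mem_closedBall_zero_iff.2 (hres y), hVQ _ (hNm y)⟩, ?_⟩
    · rw [← hw1 y]
      exact Finset.single_le_sum (f := fun j => w j y) (fun j _ => hw0 j y) (Finset.mem_univ i)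
    · rw [hΦ, hWR]
  have hy' := (hΦ y).symm.trans hy
  refine ⟨u y, y, hy.symm, ?_, ?_⟩
  · have h1 : y τ = yf - res y + W (Λ (M.orthogonalProjectionOnto (res y))) τ := by
      conv_lhs => rw [← hy']
      simp only [res, ContinuousMap.sub_apply, ContinuousMap.add_apply]
      abel
    rw [h1, _root_.map_add, _root_.map_sub, hΛ, sub_add_cancel]
  · have h1 : y - z = W (Λ (M.orthogonalProjectionOnto (res y))) - (W (R y) - V (N y)) := by
      conv_lhs => rw [← hy']
      abel
    rw [h1]
    refine (norm_sub_le _ _).trans (add_le_add ((hD _).trans ?_) (hRV y))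
    exact mul_le_mul_of_nonneg_left (hres y) hD0

/-- Approximate controllability of the unperturbed system, in terms of responses. -/
theorem exists_response_near {S : C0Semigroup 𝕜 X} {B : U →L[𝕜] X} {T : ℝ} (hT : 0 < T)
    (hAC : ∀ G : ℝ → X →L[𝕜] X, MemLp G 2 (volume.restrict (Icc 0 T)) →
      ApproximatelyControllable S B (fun t y => G t y) T)
    (y₀ yf : X) {ε : ℝ} (hε : 0 < ε) : ∃ u : controlSpace 𝕜 U T,
      ‖yf - (S.orbit T y₀ + S.response B T u) ⟨T, hT.le, le_rfl⟩‖ < ε := by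
  obtain ⟨u, y, hu, ⟨-, hy⟩, -, hyT⟩ := hAC (fun _ => 0) (memLp_const 0) y₀ yf ε hε
  refine ⟨⟨u, hu⟩, ?_⟩
  have h := hy T ⟨hT.le, le_rfl⟩
  simp only [zero_apply, add_zero] at h
  rw [norm_sub_rev]
  rw [h] at hyT
  exact hyT

/-- The projected terminal map has dense range by (AC) with `G = 0`; a dense subspace of the
finite-dimensional `M` is closed, hence everything. -/
theorem exists_rightInverse_response {S : C0Semigroup 𝕜 X} {B : U →L[𝕜] X} {T : ℝ} (hT : 0 < T)
    (hAC : ∀ G : ℝ → X →L[𝕜] X, MemLp G 2 (volume.restrict (Icc 0 T)) →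
      ApproximatelyControllable S B (fun t y => G t y) T)
    (M : Submodule 𝕜 X) [FiniteDimensional 𝕜 M] : ∃ Λ : M →ₗ[𝕜] controlSpace 𝕜 U T,
      ∀ c : M, M.orthogonalProjectionOnto (S.response B T (Λ c) ⟨T, hT.le, le_rfl⟩) = c := by
  let τ : Icc (0 : ℝ) T := ⟨T, hT.le, le_rfl⟩
  let L : controlSpace 𝕜 U T →ₗ[𝕜] M :=
    { toFun := fun u => M.orthogonalProjectionOnto (S.response B T u τ)
      map_add' := fun u v => by simp
      map_smul' := fun c u => by simp }
  have hL : LinearMap.range L = ⊤ := by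
    refine eq_top_iff.2 fun c _ => ?_
    have hcl : IsClosed (LinearMap.range L : Set M) := Submodule.closed_of_finiteDimensional _
    rw [← SetLike.mem_coe, ← hcl.closure_eq]
    refine Metric.mem_closure_iff.2 fun ε hε => ?_
    obtain ⟨u, hu⟩ := exists_response_near hT hAC 0 (c : X) hε
    refine ⟨L u, ⟨u, rfl⟩, ?_⟩
    have h0 : (S.orbit T 0 + S.response B T u) τ = S.response B T u τ := by
      change S T 0 + _ = _
      rw [_root_.map_zero, zero_add]
    rw [h0] at hu
    have h1 := M.norm_orthogonalProjectionOnto_apply_le ((c : X) - S.response B T u τ)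
    rw [_root_.map_sub, Submodule.orthogonalProjectionOnto_mem_subspace_eq_self] at h1
    rw [dist_eq_norm]
    exact h1.trans_lt hu
  obtain ⟨Λ, hΛ⟩ := L.exists_rightInverse_of_surjective hL
  exact ⟨Λ, fun c => congrArg (fun F : M →ₗ[𝕜] M => F c) hΛ⟩

end C0Semigroup

/-! ### Truncation and the main theorem. -/

/-- A nonlinearity satisfying both hypotheses is bounded on bounded sets. -/
theorem exists_norm_add_le {𝕜 X : Type*} [RCLike 𝕜] [NormedAddCommGroup X] [InnerProductSpace 𝕜 X]
    {f g : ℝ → X → X} {T : ℝ} (hf : HasBoundedC1State 𝕜 f T) (hg : IsContinuousDominated g T)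
    (R : ℝ) : ∃ m, 0 ≤ m ∧ ∀ t ∈ Icc (0 : ℝ) T, ∀ z, ‖z‖ ≤ R → ‖f t z + g t z‖ ≤ m := by
  obtain ⟨hfc, hfd, -, L, hL0, hL⟩ := hf
  obtain ⟨-, m, hmc, -, hgm⟩ := hg
  obtain ⟨a, ha⟩ := isCompact_Icc.exists_bound_of_continuousOn
    (f := fun t : ℝ => f t 0) (hfc.comp (t := Icc 0 T ×ˢ univ) (s := Icc 0 T)
      (f := fun t : ℝ => (t, (0 : X))) (by fun_prop) fun t ht => ⟨ht, mem_univ _⟩)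
  obtain ⟨b, hb⟩ := isCompact_Icc.exists_bound_of_continuousOn hmc
  refine ⟨max (a + L * R + b) 0, le_max_right _ _, fun t ht z hz => le_max_of_le_left ?_⟩
  have hlip : LipschitzWith ⟨L, hL0.le⟩ (f t) :=
    lipschitzWith_of_nnnorm_fderiv_le (𝕜 := 𝕜) (hfd t ht) fun z => hL t ht z
  have h1 := hlip.dist_le_mul z 0
  rw [dist_eq_norm, dist_zero_right] at h1
  have h2 : ‖f t z‖ ≤ ‖f t 0‖ + ‖f t z - f t 0‖ := by
    simpa using norm_add_le (f t 0) (f t z - f t 0)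
  have h3 := (le_abs_self (m t)).trans (hb t ht)
  have h4 : L * ‖z‖ ≤ L * R := mul_le_mul_of_nonneg_left hz hL0.le
  have h5 : ‖f t z - f t 0‖ ≤ L * ‖z‖ := h1
  linarith [norm_add_le (f t z) (g t z), ha t ht, hgm t ht z]

theorem mainTheorem1 {𝕜 X U : Type*} [RCLike 𝕜]
    [NormedAddCommGroup X] [InnerProductSpace 𝕜 X] [NormedSpace ℝ X]
    [CompleteSpace X] [TopologicalSpace.SeparableSpace X]
    [NormedAddCommGroup U] [InnerProductSpace 𝕜 U]
    [CompleteSpace U] [TopologicalSpace.SeparableSpace U]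
    (T : ℝ) (hT : 0 < T)
    (A : X →ₗ.[𝕜] X) (S : C0Semigroup 𝕜 X) (hA : S.IsGenerator A) (hS : S.IsCompact)
    (B : U →L[𝕜] X)
    (f g : ℝ → X → X) (hf : HasBoundedC1State 𝕜 f T) (hg : IsContinuousDominated g T)
    (hAC : ∀ G : ℝ → X →L[𝕜] X, MemLp G 2 (volume.restrict (Icc 0 T)) →
      ApproximatelyControllable S B (fun t y => G t y) T)
    (M : Submodule 𝕜 X) [FiniteDimensional 𝕜 M] :
    FiniteApproximatelyControllable S B (fun t y => f t y + g t y) T M := by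
  intro y₀ yf ε hε
  obtain ⟨Λ, hΛ⟩ := C0Semigroup.exists_rightInverse_response hT hAC M
  let WΛ : M →L[𝕜] C(Icc (0 : ℝ) T, X) :=
    LinearMap.toContinuousLinearMap ((S.response B T).comp Λ)
  let D : ℝ := ‖WΛ‖
  have hD0 : 0 ≤ D := norm_nonneg WΛ
  have hD : ∀ c, ‖S.response B T (Λ c)‖ ≤ D * ‖c‖ := WΛ.le_opNorm
  -- The trajectory will satisfy `‖y - z‖ ≤ (2 * D + 1) * η`, below `1` so that the truncation is
  -- inactive; adding the miss of `z`, less than `η`, stays below `ε`.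
  let η : ℝ := min 1 ε / (2 * D + 3)
  have hmin : 0 < min 1 ε := lt_min one_pos hε
  have hη : 0 < η := by positivity
  have hη' : η * (2 * D + 3) = min 1 ε := div_mul_cancel₀ _ (by positivity)
  obtain ⟨u₀, hu₀⟩ := C0Semigroup.exists_response_near hT hAC y₀ yf hη
  set τ : Icc (0 : ℝ) T := ⟨T, hT.le, le_rfl⟩
  set z := S.orbit T y₀ + S.response B T u₀
  have hR : 0 < ‖z‖ + 1 := by positivity
  let F : C(Icc (0 : ℝ) T × X, X) := ⟨fun p => f p.1 p.2 + g p.1 p.2, by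
    have h := hf.1.add hg.1
    exact h.comp_continuous (f := fun p : Icc (0 : ℝ) T × X => ((p.1 : ℝ), p.2)) (by fun_prop)
      fun p => ⟨p.1.2, mem_univ _⟩⟩
  -- The truncation radius `‖z‖ + 1` is fixed before the bound `m`; there is no circularity because
  -- the estimate of `‖y - z‖` does not involve `m`.
  let N : C(Icc (0 : ℝ) T, X) → C(Icc (0 : ℝ) T, X) := fun y =>
    F.comp ((ContinuousMap.id _).prodMk ((radialClip hR).comp y))
  have hN : Continuous N := by
    refine ContinuousMap.continuous_of_continuous_uncurry _ ?_
    exact F.continuous.comp (continuous_snd.prodMk ((radialClip hR).continuous.comp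
      (continuous_eval (F := C(Icc (0 : ℝ) T, X)))))
  obtain ⟨m, hm0, hm⟩ := exists_norm_add_le hf hg (‖z‖ + 1)
  have hNm : ∀ y, ‖N y‖ ≤ m := fun y => (ContinuousMap.norm_le _ hm0).2 fun s =>
    hm s s.2 _ (norm_radialClip_le hR _)
  obtain ⟨u, y, hy, hyM, hyz⟩ := C0Semigroup.exists_control_of_bounded hS hT
    (fun h hh => C0Semigroup.isTrackable_of_approximatelyControllable hT hAC hh) M Λ hΛ hD0 hD hN
    hNm y₀ yf u₀ hη
  have hyz' : ‖y - z‖ ≤ (2 * D + 1) * η := by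
    refine hyz.trans ?_
    have := mul_le_mul_of_nonneg_left hu₀.le hD0
    linarith
  have hclip : ∀ s, radialClip hR (y s) = y s := by
    intro s
    refine radialClip_of_norm_le hR ((y.norm_coe_le_norm s).trans ?_)
    have h1 : ‖y‖ ≤ ‖z‖ + ‖y - z‖ := by simpa using norm_add_le z (y - z)
    linarith [min_le_left 1 ε]
  have hyT : IccExtend hT.le y T = y τ := IccExtend_of_mem hT.le y ⟨hT.le, le_rfl⟩
  have hmild : IsMildSolution S B (fun t y => f t y + g t y) T y₀ u.1 (IccExtend hT.le y) := by
    refine ⟨y.continuous.Icc_extend'.continuousOn, fun t ht => ?_⟩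
    rw [IccExtend_of_mem hT.le y ht]
    have h1 : y ⟨t, ht⟩ = S t y₀ + S.conv (fun s => B (u.1 s)) t +
        S.conv (IccExtend hT.le (N y)) t := by
      conv_lhs => rw [hy]
      rfl
    rw [h1, add_assoc, ← S.conv_add (C0Semigroup.integrableOn_control u.2)
      (integrableOn_IccExtend hT.le (N y)) ht]
    congr 1
    refine intervalIntegral.integral_congr fun s hs => ?_
    rw [uIcc_of_le ht.1] at hs
    have hs' : s ∈ Icc 0 T := ⟨hs.1, hs.2.trans ht.2⟩
    have h2 : IccExtend hT.le (N y) s =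
        f s (IccExtend hT.le y s) + g s (IccExtend hT.le y s) := by
      rw [IccExtend_of_mem hT.le _ hs', IccExtend_of_mem hT.le _ hs']
      change f s (radialClip hR (y ⟨s, hs'⟩)) + g s (radialClip hR (y ⟨s, hs'⟩)) = _
      rw [hclip]
    simp only [h2]
  refine ⟨u.1, IccExtend hT.le y, u.2, hmild, ?_, ?_, ?_⟩
  · rw [hmild.2 0 ⟨le_rfl, hT.le⟩, intervalIntegral.integral_same, S.map_zero]
    simp
  · rw [hyT]
    have h1 : ‖y τ - z τ‖ ≤ ‖y - z‖ := (y - z).norm_coe_le_norm τ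
    have h2 := norm_sub_le_norm_sub_add_norm_sub (y τ) (z τ) yf
    rw [norm_sub_rev (z τ) yf] at h2
    linarith [min_le_right 1 ε]
  · rw [hyT, Submodule.starProjection_apply, Submodule.starProjection_apply, hyM]
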